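/- Let $F:\mathbb R\to\mathbb R$ be of class $C^1$ with $F'>0$ on $\mathbb R$, $F(0)=0$, $\lim_{x\to+\infty}F(x)=+\infty$, $L:=\lim_{x\to+\infty}F'(x)\in(0,+\infty)$, and suppose that for some $0<\underline k<\overline k$ the function $F$ is concave on $[0,\underline k]$, convex on $[\underline k,\overline k]$ and concave on $[\overline k,+\infty)$. Let $\rho>0$ and let $u:[0,+\infty)\to\mathbb R$ be continuous, strictly increasing and strictly concave, of class $C^2$ on $(0,+\infty)$, with $$u(0)=0,\quad \lim_{x\to+\infty}u(x)=+\infty,\quad \lim_{x\to0^+}u'(x)=+\infty,\quad \lim_{x\to+\infty}u'(x)=0,$$ and such that for some $\varepsilon_0>0$ $$\lim_{t\to+\infty}e^{\varepsilon_0t}e^{-\rho t}u\big(e^{(L+\varepsilon_0)t}\big)=0.$$ For $k_0\ge0$ let $\Lambda(k_0)$ be the set of all $c\in\mathcal L^1_{loc}([0,+\infty),\mathbb R)$ such that $c\ge0$ almost everywhere and the (unique) solution $k(\cdot;k_0,c)$ of the Cauchy problem $\dot k(t)=F(k(t))-c(t)$, $k(0)=k_0$ (that is, the continuous $k$ with $k(t)=k_0+\int_0^t[F(k(s))-c(s)]\,ds$)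 exists on $[0,+\infty)$ and satisfies $k(t;k_0,c)\ge0$ for all $t\ge0$. Put $$U(c;k_0):=\int_0^{+\infty}e^{-\rho t}u(c(t))\,dt\quad(c\in\Lambda(k_0)),\qquad V(k_0):=\sup_{c\in\Lambda(k_0)}U(c;k_0).$$ Then for every $k_0\ge0$: the integral $U(c;k_0)$ is finite for every $c\in\Lambda(k_0)$, $V(k_0)$ is finite, and there is an admissible control $c^*\in\Lambda(k_0)$ with $$U(c^*;k_0)=V(k_0),\qquad c^*(t)\ge0\ \text{ for every } t\ge0,\qquad c^*\in L^\infty_{loc}([0,+\infty),\mathbb R),$$ i.e. $c^*$ is essentially bounded on $[0,T]$ for every $T>0$. -/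

import Mathlib

open Set Filter Topology MeasureTheory

noncomputable section

namespace OptimalGrowth

/-- The standing assumptions on the production function `F : ℝ → ℝ`, where `L` is the limit of the
marginal product `F'` at `+∞`: `F` is `C¹` with `F' > 0`, `F 0 = 0`, `F → +∞`, `F' → L > 0`, and
`F` is concave on `[0, k₁]`, convex on `[k₁, k₂]`, concave on `[k₂, +∞)` for some `0 < k₁ < k₂`. -/
structure IsProductionFunction (F : ℝ → ℝ) (L : ℝ) : Prop where
  contDiff : ContDiff ℝ 1 F
  deriv_pos : ∀ x, 0 < deriv F x
  map_zero : F 0 = 0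
  tendsto_atTop : Tendsto F atTop atTop
  tendsto_deriv : Tendsto (deriv F) atTop (𝓝 L)
  limit_pos : 0 < L
  concave_convex_concave : ∃ k₁ k₂ : ℝ, 0 < k₁ ∧ k₁ < k₂ ∧
    ConcaveOn ℝ (Icc 0 k₁) F ∧ ConvexOn ℝ (Icc k₁ k₂) F ∧ ConcaveOn ℝ (Ici k₂) F

/-- The standing assumptions on the instantaneous utility `u : [0, +∞) → ℝ`, for the discount rate
`ρ` and the limit `L` of the marginal product. The function `u` is represented by a function on `ℝ`
whose values at negative arguments are irrelevant. -/
structure IsUtility (u : ℝ → ℝ) (L ρ : ℝ) : Prop where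
  strictMonoOn : StrictMonoOn u (Ici 0)
  strictConcaveOn : StrictConcaveOn ℝ (Ici 0) u
  contDiffOn : ContDiffOn ℝ 2 u (Ioi 0)
  continuousOn : ContinuousOn u (Ici 0)
  map_zero : u 0 = 0
  tendsto_atTop : Tendsto u atTop atTop
  tendsto_deriv_zero : Tendsto (deriv u) (𝓝[>] 0) atTop
  tendsto_deriv_atTop : Tendsto (deriv u) atTop (𝓝 0)
  growth : ∃ ε > 0, Tendsto
    (fun t : ℝ => Real.exp (ε * t) * Real.exp (-ρ * t) * u (Real.exp ((L + ε) * t))) atTop (𝓝 0)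

/-- `k` is the solution on `[0, +∞)` of `k' = F(k) - c`, `k(0) = k₀`, in the Carathéodory sense:
`k` is continuous and `k(t) = k₀ + ∫₀ᵗ (F(k(s)) - c(s)) ds` for all `t ≥ 0`. -/
structure IsOrbit (F : ℝ → ℝ) (k₀ : ℝ) (c k : ℝ → ℝ) : Prop where
  continuousOn : ContinuousOn k (Ici 0)
  integral_eq : ∀ t, 0 ≤ t → k t = k₀ + ∫ s in (0 : ℝ)..t, (F (k s) - c s)

/-- The set `Λ(k₀)` of admissible controls: the locally integrable functions on `[0, +∞)` which are
almost everywhere nonnegative and whose orbit starting at `k₀` exists and is nonnegative on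
`[0, +∞)`. The orbit is unique, see `IsOrbit.eqOn`. -/
def admissible (F : ℝ → ℝ) (k₀ : ℝ) : Set (ℝ → ℝ) :=
  {c | LocallyIntegrableOn c (Ici 0) ∧ (∀ᵐ t ∂(volume.restrict (Ici (0 : ℝ))), 0 ≤ c t) ∧
    ∃ k, IsOrbit F k₀ c k ∧ ∀ t, 0 ≤ t → 0 ≤ k t}

/-- The intertemporal utility `U(c) = ∫₀^∞ e^{-ρt} u(c(t)) dt`. -/
def intertemporalUtility (u : ℝ → ℝ) (ρ : ℝ) (c : ℝ → ℝ) : ℝ :=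
  ∫ t in Ici (0 : ℝ), Real.exp (-ρ * t) * u (c t)

/-- The value function `V(k₀) = sup {U(c) | c ∈ Λ(k₀)}`. -/
def valueFunction (F u : ℝ → ℝ) (ρ k₀ : ℝ) : ℝ :=
  sSup (intertemporalUtility u ρ '' admissible F k₀)

/-- Uniqueness of the orbit: two orbits with the same initial datum and the same locally integrable
control agree on `[0, +∞)`. -/
theorem IsOrbit.eqOn {F : ℝ → ℝ} (hF : ContDiff ℝ 1 F) {k₀ : ℝ} {c k l : ℝ → ℝ}
    (hc : LocallyIntegrableOn c (Ici 0)) (hk : IsOrbit F k₀ c k) (hl : IsOrbit F k₀ c l) :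
    EqOn k l (Ici 0) := by
  intro T hT
  have hT : (0 : ℝ) ≤ T := hT
  have hsub : Icc (0 : ℝ) T ⊆ Ici 0 := fun x hx => hx.1
  have hkT := hk.continuousOn.mono hsub
  have hlT := hl.continuousOn.mono hsub
  obtain ⟨R, hR⟩ := ((isCompact_Icc.image_of_continuousOn hkT).union
    (isCompact_Icc.image_of_continuousOn hlT)).isBounded.subset_closedBall 0
  obtain ⟨K, hK⟩ := (hF.locallyLipschitz.locallyLipschitzOn (s := Metric.closedBall (0 : ℝ) R)
    ).exists_lipschitzOnWith_of_compact (isCompact_closedBall 0 R)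
  have hFk : ContinuousOn (fun s => F (k s)) (Ici 0) := hF.continuous.comp_continuousOn hk.continuousOn
  have hFl : ContinuousOn (fun s => F (l s)) (Ici 0) := hF.continuous.comp_continuousOn hl.continuousOn
  have hint : ∀ {f : ℝ → ℝ}, LocallyIntegrableOn f (Ici 0) → ∀ t, 0 ≤ t →
      IntervalIntegrable f volume 0 t := by
    intro f hf t ht
    rw [intervalIntegrable_iff_integrableOn_Icc_of_le ht]
    exact hf.integrableOn_compact_subset (fun x hx => hx.1) isCompact_Icc
  have hFkL := hFk.locallyIntegrableOn (μ := volume) measurableSet_Ici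
  have hFlL := hFl.locallyIntegrableOn (μ := volume) measurableSet_Ici
  have hd : ∀ t, 0 ≤ t → k t - l t = ∫ s in (0 : ℝ)..t, (F (k s) - F (l s)) := by
    intro t ht
    rw [hk.integral_eq t ht, hl.integral_eq t ht,
      intervalIntegral.integral_sub (hint hFkL t ht) (hint hc t ht),
      intervalIntegral.integral_sub (hint hFlL t ht) (hint hc t ht),
      intervalIntegral.integral_sub (hint hFkL t ht) (hint hFlL t ht)]
    ring
  have hg : ContinuousOn (fun s => F (k s) - F (l s)) (Ici 0) := hFk.sub hFl
  have hderiv : ∀ x ∈ Ico (0 : ℝ) T,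
      HasDerivWithinAt (fun t => k t - l t) (F (k x) - F (l x)) (Ici x) x := by
    intro x hx
    have hsx : Ici x ⊆ Ici (0 : ℝ) := Ici_subset_Ici.2 hx.1
    have h := intervalIntegral.integral_hasDerivWithinAt_right (a := (0 : ℝ)) (b := x)
      (s := Ici x) (t := Ioi x) (hint (hFkL.sub hFlL) x hx.1)
      ⟨Ici x, mem_of_superset self_mem_nhdsWithin Ioi_subset_Ici_self,
        (hg.mono hsx).aestronglyMeasurable measurableSet_Ici⟩
      ((hg x hx.1).mono (Ioi_subset_Ici_self.trans hsx))
    exact h.congr (fun y hy => hd y (hx.1.trans hy)) (hd x hx.1)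
  have hbound : ∀ x ∈ Ico (0 : ℝ) T, ‖F (k x) - F (l x)‖ ≤ K * ‖k x - l x‖ + 0 := by
    intro x hx
    have hx' : x ∈ Icc (0 : ℝ) T := ⟨hx.1, hx.2.le⟩
    rw [add_zero]
    exact hK.norm_sub_le (hR (Or.inl (mem_image_of_mem k hx')))
      (hR (Or.inr (mem_image_of_mem l hx')))
  have h0 : ‖k 0 - l 0‖ ≤ 0 := by
    rw [hd 0 le_rfl]; simp
  have := norm_le_gronwallBound_of_norm_deriv_right_le (hkT.sub hlT) hderiv h0 hbound T ⟨hT, le_rfl⟩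
  rw [gronwallBound_ε0_δ0] at this
  exact sub_eq_zero.1 (norm_le_zero_iff.1 this)

end OptimalGrowth

end

/-!
Existence of an optimal consumption plan by the direct method, without convexity of the dynamics.

Capital grows at most like `exp ((L + ε) t)` by Grönwall's inequality, so the accumulated consumption
of an admissible control obeys the same bound and `∫ exp (-(L + 2ε) t) c(t) dt` is bounded uniformly
over all admissible `c` (`IsProductionFunction.exists_integral_exp_mul_le`). The growth condition on
`u` and its concavity give, for every `η > 0`, a majorant
`exp (-ρt) u(c) ≤ K exp (-εt) + η exp (-(L + 2ε) t) c` (`IsUtility.exists_discounted_le`). Together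
these make `U` finite and bounded above.

Along a maximizing sequence `c n` consumption may concentrate, so the controls need not converge
weakly to a control. Two compactness arguments are combined instead. Helly's selection principle,
applied to the accumulated consumption and to the accumulated production (both monotone in time),
makes the capital stocks converge almost everywhere (`exists_subseq_orbit_tendsto`), which is what
the nonlinear, nonconcave `F` needs. A Komlós-type lemma (`exists_convexHull_ae_tendsto`) yields
convex combinations of the tails of `c n` that converge almost everywhere to some `c`, which is what
the concave functional `U` needs. By Fatou's lemma the accumulated consumption of `c` is at most the
limit of the accumulated consumptions, the difference being what has concentrated, and by the
majorant and `η → 0` its utility is at least the supremum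
(`exists_admissible_le_intertemporalUtility`).

Since `F` is increasing, consuming less in accumulated terms is always feasible: a continuous
nonnegative subsolution of the orbit equation is the start of a monotone iteration that converges to
an orbit (`mem_admissible_of_subsolution`). Hence `c` is admissible, and optimal.

An optimal control is bounded on `[0, T]`: otherwise cut it at a large level `N` on `(0, T]` and spend
the amount saved uniformly on `(T, T + 1]`. The accumulated consumption never exceeds the original
one, so this is admissible; the loss is at most `sup_{x ≥ N} u'(x)` times the amount saved, whereas
the gain is at least a fixed positive multiple of it
(`exists_ae_le_of_forall_intertemporalUtility_le`).
-/

namespace OptimalGrowth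

/-! ### Almost everywhere limits: Fatou, Helly and Komlós -/

/-- Fatou's lemma for the Bochner integral of nonnegative real functions. -/
theorem integrable_and_integral_le_of_tendsto {α : Type*} [MeasurableSpace α] {μ : Measure α}
    {h : ℕ → α → ℝ} {g : α → ℝ} {r : ℕ → ℝ} {R : ℝ} (hint : ∀ n, Integrable (h n) μ)
    (hnn : ∀ n, 0 ≤ᵐ[μ] h n) (hle : ∀ n, ∫ x, h n x ∂μ ≤ r n) (hr : Tendsto r atTop (𝓝 R))
    (hlim : ∀ᵐ x ∂μ, Tendsto (fun n => h n x) atTop (𝓝 (g x))) :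
    Integrable g μ ∧ ∫ x, g x ∂μ ≤ R := by
  have hg : AEStronglyMeasurable g μ :=
    aestronglyMeasurable_of_tendsto_ae atTop (fun n => (hint n).aestronglyMeasurable) hlim
  have hg0 : 0 ≤ᵐ[μ] g := by
    filter_upwards [hlim, ae_all_iff.2 hnn] with x hx hx0
    exact ge_of_tendsto' hx hx0
  have hR : 0 ≤ R := ge_of_tendsto' hr fun n => (integral_nonneg_of_ae (hnn n)).trans (hle n)
  have key : ∫⁻ x, ENNReal.ofReal (g x) ∂μ ≤ ENNReal.ofReal R := by
    calc ∫⁻ x, ENNReal.ofReal (g x) ∂μ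
        = ∫⁻ x, liminf (fun n => ENNReal.ofReal (h n x)) atTop ∂μ := by
          refine lintegral_congr_ae ?_
          filter_upwards [hlim] with x hx
          exact ((ENNReal.continuous_ofReal.tendsto _).comp hx).liminf_eq.symm
      _ ≤ liminf (fun n => ∫⁻ x, ENNReal.ofReal (h n x) ∂μ) atTop :=
          lintegral_liminf_le' fun n => (hint n).aestronglyMeasurable.aemeasurable.ennreal_ofReal
      _ ≤ liminf (fun n => ENNReal.ofReal (r n)) atTop := by
          refine liminf_le_liminf (Eventually.of_forall fun n => ?_)
          rw [← ofReal_integral_eq_lintegral_ofReal (hint n) (hnn n)]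
          exact ENNReal.ofReal_le_ofReal (hle n)
      _ = ENNReal.ofReal R := ((ENNReal.continuous_ofReal.tendsto _).comp hr).liminf_eq
  refine ⟨⟨hg, ?_⟩, ?_⟩
  · rw [hasFiniteIntegral_iff_ofReal hg0]
    exact key.trans_lt ENNReal.ofReal_lt_top
  · rw [integral_eq_lintegral_of_nonneg_ae hg0 hg]
    exact ENNReal.toReal_le_of_le_ofReal hR key

/-- Helly's selection principle: a pointwise bounded sequence of monotone functions has a subsequence
that converges almost everywhere. -/
theorem exists_subseq_ae_tendsto_of_monotone {f : ℕ → ℝ → ℝ} (hf : ∀ n, Monotone (f n))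
    {b B : ℝ → ℝ} (hb : ∀ n t, b t ≤ f n t) (hB : ∀ n t, f n t ≤ B t) :
    ∃ φ : ℕ → ℕ, StrictMono φ ∧ ∃ g : ℝ → ℝ, ∀ᵐ t, Tendsto (fun n => f (φ n) t) atTop (𝓝 (g t)) := by
  have hK : IsCompact (Set.univ.pi fun q : ℚ => Icc (b q) (B q)) :=
    isCompact_univ_pi fun q => isCompact_Icc
  obtain ⟨G, -, φ, hφ, hG⟩ := hK.tendsto_subseq (x := fun n (q : ℚ) => f n q)
    (fun n q _ => ⟨hb n q, hB n q⟩)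
  have hGq : ∀ q : ℚ, Tendsto (fun n => f (φ n) q) atTop (𝓝 (G q)) := tendsto_pi_nhds.1 hG
  have hGm : Monotone G := fun p q hpq =>
    le_of_tendsto_of_tendsto' (hGq p) (hGq q) fun n => hf _ (by exact_mod_cast hpq)
  -- the left-continuous extension of `G`; at its continuity points the functions `f (φ n)` are squeezed
  -- between their values at nearby rationals
  let g : ℝ → ℝ := fun t => sSup (G '' {q : ℚ | (q : ℝ) < t})
  have hbdd : ∀ t : ℝ, BddAbove (G '' {q : ℚ | (q : ℝ) < t}) := by
    intro t
    obtain ⟨r, hr⟩ := exists_rat_gt t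
    refine ⟨G r, ?_⟩
    rintro _ ⟨q, hq, rfl⟩
    exact hGm (by exact_mod_cast (lt_trans hq hr).le)
  have hne : ∀ t : ℝ, (G '' {q : ℚ | (q : ℝ) < t}).Nonempty := by
    intro t
    obtain ⟨r, hr⟩ := exists_rat_lt t
    exact ⟨_, r, hr, rfl⟩
  have hgm : Monotone g := fun s t hst => csSup_le_csSup (hbdd t) (hne s)
    (image_mono fun q hq => lt_of_lt_of_le hq hst)
  refine ⟨φ, hφ, g, ?_⟩
  have hc : ∀ᵐ t : ℝ, ContinuousAt g t :=
    measure_mono_null (fun t ht => ht) (hgm.countable_not_continuousAt.measure_zero volume)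
  filter_upwards [hc] with t ht
  rw [tendsto_order]
  constructor
  · intro a ha
    obtain ⟨_, ⟨q, hq, rfl⟩, haq⟩ := exists_lt_of_lt_csSup (hne t) ha
    filter_upwards [(hGq q).eventually_const_lt haq] with n hn
    exact hn.trans_le (hf _ (le_of_lt hq))
  · intro a ha
    have h1 : ∀ᶠ s in 𝓝[>] t, g s < a := (ht.eventually_lt_const ha).filter_mono nhdsWithin_le_nhds
    obtain ⟨s, hs, hts⟩ := (h1.and self_mem_nhdsWithin).exists
    obtain ⟨q, hq1, hq2⟩ := exists_rat_btwn (show t < s from hts)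
    have hGa : G q < a := (le_csSup (hbdd s) ⟨q, hq2, rfl⟩).trans_lt hs
    filter_upwards [(hGq q).eventually_lt_const hGa] with n hn
    exact (hf _ hq1.le).trans_lt hn

theorem convex_setOf_integral_le {α : Type*} [MeasurableSpace α] {μ : Measure α} (w : α → ℝ)
    (r : ℝ) : Convex ℝ {c : α → ℝ | Integrable (fun x => w x * c x) μ ∧ ∫ x, w x * c x ∂μ ≤ r} := by
  rintro c ⟨hci, hcr⟩ d ⟨hdi, hdr⟩ α β hα hβ hαβ
  have heq : (fun x => w x * (α • c + β • d) x)
      = fun x => α * (w x * c x) + β * (w x * d x) := by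
    ext x; simp; ring
  refine ⟨?_, ?_⟩
  · rw [heq]
    exact (hci.const_mul α).add (hdi.const_mul β)
  · rw [heq, integral_add (hci.const_mul α) (hdi.const_mul β), integral_const_mul,
      integral_const_mul]
    calc α * _ + β * _ ≤ α * r + β * r := by gcongr
      _ = r := by rw [← add_mul, hαβ, one_mul]

theorem convex_setOf_ae_nonneg {α : Type*} [MeasurableSpace α] {μ : Measure α} :
    Convex ℝ {c : α → ℝ | 0 ≤ᵐ[μ] c} := by
  intro c hc d hd a b ha hb _
  filter_upwards [show 0 ≤ᵐ[μ] c from hc, show 0 ≤ᵐ[μ] d from hd] with x h1 h2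
  simp only [Pi.zero_apply, Pi.add_apply, Pi.smul_apply, smul_eq_mul] at *
  positivity

/-- Given nonnegative functions `f n` on a finite measure space, some convex combinations `g n` of the
tails of `f` are such that `exp (-g n)` converges almost everywhere. The `g n` nearly minimize the
bounded, strictly convex functional `g ↦ ∫ exp (-2g)` over the tails; the defect of convexity at a
midpoint is `(exp (-g n) - exp (-g m))² / 2`, so that `exp (-g n)` is Cauchy in `L²`. -/
theorem exists_convexHull_ae_tendsto_exp_neg {α : Type*} [MeasurableSpace α] {μ : Measure α}
    [IsFiniteMeasure μ] {f : ℕ → α → ℝ} (hf : ∀ n, AEStronglyMeasurable (f n) μ)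
    (hf0 : ∀ n, 0 ≤ᵐ[μ] f n) :
    ∃ g : ℕ → α → ℝ, (∀ n, g n ∈ convexHull ℝ (f '' Ici n)) ∧
      ∀ᵐ x ∂μ, ∃ l, Tendsto (fun n => Real.exp (-g n x)) atTop (𝓝 l) := by
  let S : Set (α → ℝ) := {g | AEStronglyMeasurable g μ ∧ 0 ≤ᵐ[μ] g}
  have hS : Convex ℝ S := by
    rintro g ⟨hg, hg0⟩ h ⟨hh, hh0⟩ a b ha hb hab
    exact ⟨(hg.const_smul a).add (hh.const_smul b), convex_setOf_ae_nonneg hg0 hh0 ha hb hab⟩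
  have hsub : ∀ n, convexHull ℝ (f '' Ici n) ⊆ S := fun n =>
    convexHull_min (by rintro _ ⟨j, -, rfl⟩; exact ⟨hf j, hf0 j⟩) hS
  have hanti : ∀ {m n : ℕ}, m ≤ n → convexHull ℝ (f '' Ici n) ⊆ convexHull ℝ (f '' Ici m) :=
    fun h => convexHull_mono (image_mono (Ici_subset_Ici.2 h))
  have hbd : ∀ {g}, g ∈ S → ∀ᵐ x ∂μ, ‖Real.exp (-g x)‖ ≤ 1 := by
    rintro g ⟨-, hg0⟩
    filter_upwards [hg0] with x hx
    simpa [Real.norm_eq_abs] using hx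
  have hmeas : ∀ {g}, g ∈ S → AEStronglyMeasurable (fun x => Real.exp (-g x)) μ := fun hg =>
    Real.continuous_exp.comp_aestronglyMeasurable hg.1.neg
  have hmemLp : ∀ {g}, g ∈ S → MemLp (fun x => Real.exp (-g x)) 2 μ := fun hg =>
    MemLp.of_bound (hmeas hg) 1 (hbd hg)
  let Φ : (α → ℝ) → ℝ := fun g => ∫ x, Real.exp (-g x) ^ 2 ∂μ
  have hΦ0 : ∀ g, 0 ≤ Φ g := fun g => integral_nonneg fun x => sq_nonneg _
  have hint : ∀ {g}, g ∈ S → Integrable (fun x => Real.exp (-g x) ^ 2) μ := fun hg =>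
    (hmemLp hg).integrable_sq
  let I : ℕ → ℝ := fun n => sInf (Φ '' convexHull ℝ (f '' Ici n))
  have hIbdd : ∀ n, BddBelow (Φ '' convexHull ℝ (f '' Ici n)) := fun n =>
    ⟨0, by rintro _ ⟨g, -, rfl⟩; exact hΦ0 g⟩
  have hfmem : ∀ n, f n ∈ convexHull ℝ (f '' Ici n) := fun n =>
    subset_convexHull ℝ _ ⟨n, self_mem_Ici, rfl⟩
  have hIm : Monotone I := fun m n h => csInf_le_csInf (hIbdd m) ⟨_, _, hfmem n, rfl⟩
    (image_mono (hanti h))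
  have hIB : BddAbove (range I) := by
    refine ⟨∫ x, (1 : ℝ) ∂μ, ?_⟩
    rintro _ ⟨n, rfl⟩
    refine (csInf_le (hIbdd n) ⟨f n, hfmem n, rfl⟩).trans ?_
    refine integral_mono_ae (hint (hsub n (hfmem n))) (integrable_const _) ?_
    filter_upwards [hbd (hsub n (hfmem n))] with x hx
    rw [Real.norm_eq_abs] at hx
    exact (sq_le_one_iff_abs_le_one _).2 hx
  let J : ℝ := ⨆ n, I n
  have hJ : Tendsto I atTop (𝓝 J) := tendsto_atTop_ciSup hIm hIB
  -- tolerance chosen so that `√(4 * δ n) = (1 / 2) ^ n / 2`, which is summable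
  let δ : ℕ → ℝ := fun n => (1 / 4) * ((1 / 2) ^ n) ^ 2 / 4
  have hδ : ∀ n, 0 < δ n := fun n => by positivity
  have hδanti : ∀ {m n : ℕ}, m ≤ n → δ n ≤ δ m := by
    intro m n h
    have : ((1 / 2 : ℝ)) ^ n ≤ (1 / 2) ^ m := pow_le_pow_of_le_one (by norm_num) (by norm_num) h
    have h2 : ((1 / 2 : ℝ) ^ n) ^ 2 ≤ ((1 / 2) ^ m) ^ 2 := by gcongr
    simp only [δ]; linarith
  have hs : ∀ n, ∃ s, n ≤ s ∧ J - δ n < I s := fun n =>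
    ((eventually_ge_atTop n).and (hJ.eventually_const_lt (sub_lt_self J (hδ n)))).exists
  choose s hsn hsI using hs
  have hg : ∀ n, ∃ g ∈ convexHull ℝ (f '' Ici (s n)), Φ g < J + δ n := by
    intro n
    have : I (s n) < J + δ n := (le_ciSup hIB (s n)).trans_lt (lt_add_of_pos_right _ (hδ n))
    obtain ⟨_, ⟨g, hg, rfl⟩, h⟩ := exists_lt_of_csInf_lt
      (show (Φ '' convexHull ℝ (f '' Ici (s n))).Nonempty from ⟨_, _, hfmem (s n), rfl⟩) this
    exact ⟨g, hg, h⟩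
  choose g hgm hgΦ using hg
  have hgS : ∀ n, g n ∈ S := fun n => hsub _ (hgm n)
  refine ⟨g, fun n => hanti (hsn n) (hgm n), ?_⟩
  refine Lp.ae_tendsto_of_cauchy_eLpNorm (p := 2) (fun n => hmeas (hgS n)) (by norm_num)
    (B := fun n => ENNReal.ofReal ((1 / 2) ^ n)) ?_ ?_
  · rw [← ENNReal.ofReal_tsum_of_nonneg (fun n => by positivity)
      (summable_geometric_of_lt_one (by norm_num) (by norm_num))]
    exact ENNReal.ofReal_ne_top
  intro N n m hn hm
  -- the midpoint of `g n` and `g m` is a competitor, so it cannot do much better than either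
  have hmid : J - δ N < Φ ((1 / 2 : ℝ) • g n + (1 / 2 : ℝ) • g m) := by
    rcases le_total (s n) (s m) with h | h
    · refine ((sub_le_sub_left (hδanti hn) J).trans_lt (hsI n)).trans_le
        (csInf_le (hIbdd _) ⟨_, ?_, rfl⟩)
      exact convex_convexHull ℝ _ (hgm n) (hanti h (hgm m)) (by norm_num) (by norm_num) (by norm_num)
    · refine ((sub_le_sub_left (hδanti hm) J).trans_lt (hsI m)).trans_le
        (csInf_le (hIbdd _) ⟨_, ?_, rfl⟩)
      exact convex_convexHull ℝ _ (hanti h (hgm n)) (hgm m) (by norm_num) (by norm_num) (by norm_num)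
  have hmidS : (1 / 2 : ℝ) • g n + (1 / 2 : ℝ) • g m ∈ S :=
    hS (hgS n) (hgS m) (by norm_num) (by norm_num) (by norm_num)
  have hsq : ∫ x, (Real.exp (-g n x) - Real.exp (-g m x)) ^ 2 ∂μ
      = Φ (g n) + Φ (g m) - 2 * Φ ((1 / 2 : ℝ) • g n + (1 / 2 : ℝ) • g m) := by
    simp only [Φ]
    rw [← integral_const_mul, ← integral_add (hint (hgS n)) (hint (hgS m)),
      ← integral_sub (by exact (hint (hgS n)).add (hint (hgS m))) ((hint hmidS).const_mul 2)]
    refine integral_congr_ae (Eventually.of_forall fun x => ?_)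
    have : Real.exp (-((1 / 2 : ℝ) • g n + (1 / 2 : ℝ) • g m) x) ^ 2
        = Real.exp (-g n x) * Real.exp (-g m x) := by
      rw [← Real.exp_nat_mul, ← Real.exp_add]
      congr 1
      simp; ring
    simp only [this]
    ring
  have hlt : ∫ x, (Real.exp (-g n x) - Real.exp (-g m x)) ^ 2 ∂μ ≤ 4 * δ N := by
    rw [hsq]
    have h1 := hgΦ n
    have h2 := hgΦ m
    have h3 := hδanti hn
    have h4 := hδanti hm
    linarith
  rw [((hmemLp (hgS n)).sub (hmemLp (hgS m))).eLpNorm_eq_integral_rpow_norm (by norm_num)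
    (by norm_num)]
  refine (ENNReal.ofReal_lt_ofReal_iff (by positivity)).2 ?_
  have hrew : ∫ x, ‖((fun x => Real.exp (-g n x)) - fun x => Real.exp (-g m x)) x‖ ^
      (2 : ENNReal).toReal ∂μ = ∫ x, (Real.exp (-g n x) - Real.exp (-g m x)) ^ 2 ∂μ := by
    simp
  rw [hrew]
  have h2 : (2 : ENNReal).toReal⁻¹ = 1 / 2 := by norm_num
  rw [h2, ← Real.sqrt_eq_rpow]
  refine (Real.sqrt_le_sqrt hlt).trans_lt ?_
  rw [Real.sqrt_lt' (by positivity)]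
  have : (0 : ℝ) < ((1 / 2) ^ N) ^ 2 := by positivity
  simp only [δ]
  linarith

/-- A Komlós-type lemma: if nonnegative functions `f n` are bounded in some weighted `L¹` space, then
suitable convex combinations of the tails of `f` converge almost everywhere to a finite limit. -/
theorem exists_convexHull_ae_tendsto {α : Type*} [MeasurableSpace α] {μ : Measure α} [SigmaFinite μ]
    {f : ℕ → α → ℝ} (hf0 : ∀ n, 0 ≤ᵐ[μ] f n) {w : α → ℝ} (hw : ∀ x, 0 < w x)
    (hwm : AEStronglyMeasurable w μ) {B : ℝ} (hint : ∀ n, Integrable (fun x => w x * f n x) μ)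
    (hB : ∀ n, ∫ x, w x * f n x ∂μ ≤ B) :
    ∃ g : ℕ → α → ℝ, (∀ n, g n ∈ convexHull ℝ (f '' Ici n)) ∧
      ∃ h : α → ℝ, ∀ᵐ x ∂μ, Tendsto (fun n => g n x) atTop (𝓝 (h x)) := by
  have hf : ∀ n, AEStronglyMeasurable (f n) μ := by
    intro n
    refine (((hwm.aemeasurable.inv).mul (hint n).aestronglyMeasurable.aemeasurable).congr
      (Eventually.of_forall fun x => ?_)).aestronglyMeasurable
    simp only [Pi.mul_apply, Pi.inv_apply]
    rw [inv_mul_cancel_left₀ (hw x).ne']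
  obtain ⟨g, hg, hlim⟩ := exists_convexHull_ae_tendsto_exp_neg (μ := μ.toFinite)
    (fun n => (hf n).mono_ac (toFinite_absolutelyContinuous μ))
    (fun n => (toFinite_absolutelyContinuous μ).ae_le (hf0 n))
  replace hlim := (absolutelyContinuous_toFinite μ).ae_le hlim
  have hgc : ∀ n, 0 ≤ᵐ[μ] g n ∧ Integrable (fun x => w x * g n x) μ ∧ ∫ x, w x * g n x ∂μ ≤ B :=
    fun n => convexHull_min (by rintro _ ⟨j, -, rfl⟩; exact ⟨hf0 j, hint j, hB j⟩)
      (convex_setOf_ae_nonneg.inter (convex_setOf_integral_le w B)) (hg n)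
  -- by Fatou's lemma `g n` does not tend to `∞`, so the limit of `exp (-g n)` does not vanish
  have hfin : ∀ᵐ x ∂μ, liminf (fun n => ENNReal.ofReal (w x * g n x)) atTop < ⊤ := by
    have hm : ∀ n, AEMeasurable (fun x => ENNReal.ofReal (w x * g n x)) μ := fun n =>
      (hgc n).2.1.aestronglyMeasurable.aemeasurable.ennreal_ofReal
    have hm' : AEMeasurable (fun x => liminf (fun n => ENNReal.ofReal (w x * g n x)) atTop) μ := by
      simp only [liminf_eq_iSup_iInf_of_nat]
      exact .iSup fun n => .biInf _ (to_countable _) fun i _ => hm i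
    refine ae_lt_top' hm' (ne_top_of_le_ne_top
      (ENNReal.ofReal_ne_top (r := B)) ((lintegral_liminf_le' hm).trans ?_))
    refine (liminf_le_liminf (v := fun _ => ENNReal.ofReal B)
      (Eventually.of_forall fun n => ?_)).trans_eq (liminf_const _)
    rw [← ofReal_integral_eq_lintegral_ofReal (hgc n).2.1]
    · exact ENNReal.ofReal_le_ofReal (hgc n).2.2
    · filter_upwards [(hgc n).1] with x hx
      exact mul_nonneg (hw x).le hx
  have hreal : ∀ᵐ x ∂μ, ∃ l, Tendsto (fun n => g n x) atTop (𝓝 l) := by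
    filter_upwards [hlim, hfin] with x ⟨l, hl⟩ hx
    have hl0 : l ≠ 0 := by
      rintro rfl
      have h1 : Tendsto (fun n => w x * g n x) atTop atTop :=
        (tendsto_neg_atBot_iff.1 (Real.tendsto_exp_comp_nhds_zero.1 hl)).const_mul_atTop (hw x)
      exact hx.ne (ENNReal.tendsto_ofReal_atTop.comp h1).liminf_eq
    refine ⟨-Real.log l, ?_⟩
    simpa using ((Real.continuousAt_log hl0).tendsto.comp hl).neg
  classical
  refine ⟨g, hg, fun x => if h : ∃ l, Tendsto (fun n => g n x) atTop (𝓝 l) then h.choose else 0, ?_⟩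
  filter_upwards [hreal] with x hx
  rw [dif_pos hx]
  exact hx.choose_spec

/-! ### Orbits, subsolutions and growth bounds -/

theorem intervalIntegrable_of_locallyIntegrableOn_Ici {f : ℝ → ℝ}
    (hf : LocallyIntegrableOn f (Ici 0)) {t : ℝ} (ht : 0 ≤ t) :
    IntervalIntegrable f volume 0 t := by
  rw [intervalIntegrable_iff_integrableOn_Icc_of_le ht]
  exact hf.integrableOn_compact_subset (fun x hx => hx.1) isCompact_Icc

theorem locallyIntegrableOn_Ici_of_intervalIntegrable {f : ℝ → ℝ}
    (hf : ∀ t, 0 ≤ t → IntervalIntegrable f volume 0 t) : LocallyIntegrableOn f (Ici 0) := by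
  rw [locallyIntegrableOn_iff isClosed_Ici.isLocallyClosed]
  intro K hK hKc
  obtain ⟨T, hT⟩ := hKc.isBounded.bddAbove
  have h := (intervalIntegrable_iff_integrableOn_Icc_of_le (le_max_right T 0)).1
    (hf (max T 0) (le_max_right _ _))
  exact h.mono_set fun x hx => ⟨hK hx, (hT hx).trans (le_max_left _ _)⟩

theorem continuousOn_Ici_integral {f : ℝ → ℝ} (hf : LocallyIntegrableOn f (Ici 0)) :
    ContinuousOn (fun t => ∫ s in (0 : ℝ)..t, f s) (Ici 0) := by
  intro t ht
  have ht0 : (0 : ℝ) ≤ t := ht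
  have h1 : (0 : ℝ) ≤ t + 1 := by linarith
  have h := intervalIntegral.continuousOn_primitive_interval'
    (intervalIntegrable_of_locallyIntegrableOn_Ici hf h1) left_mem_uIcc
  rw [uIcc_of_le h1] at h
  refine (h t ⟨ht0, by linarith⟩).mono_of_mem_nhdsWithin ?_
  filter_upwards [self_mem_nhdsWithin, nhdsWithin_le_nhds (Iio_mem_nhds (lt_add_one t))]
    with x hx hx' using ⟨hx, le_of_lt hx'⟩

theorem intervalIntegral_mono_of_locallyIntegrableOn_Ici {f g : ℝ → ℝ}
    (hf : LocallyIntegrableOn f (Ici 0)) (hg : LocallyIntegrableOn g (Ici 0)) {t : ℝ} (ht : 0 ≤ t)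
    (h : ∀ s, 0 ≤ s → f s ≤ g s) : ∫ s in (0 : ℝ)..t, f s ≤ ∫ s in (0 : ℝ)..t, g s :=
  intervalIntegral.integral_mono_on ht (intervalIntegrable_of_locallyIntegrableOn_Ici hf ht)
    (intervalIntegrable_of_locallyIntegrableOn_Ici hg ht) fun s hs => h s hs.1

theorem intervalIntegral_nonneg_of_ae_Ici {c : ℝ → ℝ}
    (hc0 : ∀ᵐ t ∂(volume.restrict (Ici (0 : ℝ))), 0 ≤ c t) {s t : ℝ} (hs : 0 ≤ s) (hst : s ≤ t) :
    0 ≤ ∫ r in s..t, c r := by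
  rw [intervalIntegral.integral_of_le hst]
  exact integral_nonneg_of_ae (ae_restrict_of_ae_restrict_of_subset
    (fun x hx => hs.trans (le_of_lt hx.1)) hc0)

/-- Grönwall's inequality in integral form. -/
theorem le_gronwallBound_of_le_integral {y : ℝ → ℝ} {k₀ a b : ℝ} (ha : 0 ≤ a)
    (hy : ContinuousOn y (Ici 0))
    (h : ∀ t, 0 ≤ t → y t ≤ k₀ + ∫ s in (0 : ℝ)..t, (b + a * y s)) {t : ℝ} (ht : 0 ≤ t) :
    y t ≤ gronwallBound k₀ a b t := by
  have hg : ContinuousOn (fun s => b + a * y s) (Ici 0) :=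
    continuousOn_const.add (continuousOn_const.mul hy)
  have hgl := hg.locallyIntegrableOn (μ := volume) measurableSet_Ici
  refine (h t ht).trans ?_
  have key := le_gronwallBound_of_liminf_deriv_right_le (a := 0) (b := t)
    (f := fun t => k₀ + ∫ s in (0 : ℝ)..t, (b + a * y s)) (f' := fun s => b + a * y s)
    (δ := k₀) (K := a) (ε := b)
    ((continuousOn_const.add (continuousOn_Ici_integral hgl)).mono fun x hx => hx.1) ?_ (by simp)
    ?_ t ⟨ht, le_rfl⟩
  · simpa using key
  · intro x hx r hr
    have hsx : Ici x ⊆ Ici (0 : ℝ) := Ici_subset_Ici.2 hx.1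
    have h := intervalIntegral.integral_hasDerivWithinAt_right (a := (0 : ℝ)) (b := x)
      (s := Ici x) (t := Ioi x) (intervalIntegrable_of_locallyIntegrableOn_Ici hgl hx.1)
      ⟨Ici x, mem_of_superset self_mem_nhdsWithin Ioi_subset_Ici_self,
        (hg.mono hsx).aestronglyMeasurable measurableSet_Ici⟩
      ((hg x hx.1).mono (Ioi_subset_Ici_self.trans hsx))
    exact (h.const_add k₀).liminf_right_slope_le hr
  · intro x hx
    have := mul_le_mul_of_nonneg_left (h x hx.1) ha
    linarith

theorem gronwallBound_le_mul_exp {k₀ a b t : ℝ} (ha : 0 < a) (hb : 0 ≤ b) :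
    gronwallBound k₀ a b t ≤ (k₀ + b / a) * Real.exp (a * t) := by
  rw [gronwallBound_of_K_ne_0 ha.ne']
  have : 0 ≤ b / a := by positivity
  dsimp only
  linarith

/-- The orbit equation in terms of accumulated production and accumulated consumption. -/
theorem isOrbit_iff {F : ℝ → ℝ} (hF : Continuous F) {k₀ : ℝ} {c k : ℝ → ℝ}
    (hc : LocallyIntegrableOn c (Ici 0)) :
    IsOrbit F k₀ c k ↔ ContinuousOn k (Ici 0) ∧
      ∀ t, 0 ≤ t → k t = k₀ + (∫ s in (0 : ℝ)..t, F (k s)) - ∫ s in (0 : ℝ)..t, c s := by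
  have hsplit : ContinuousOn k (Ici 0) → ∀ t, 0 ≤ t → k₀ + ∫ s in (0 : ℝ)..t, (F (k s) - c s)
      = k₀ + (∫ s in (0 : ℝ)..t, F (k s)) - ∫ s in (0 : ℝ)..t, c s := by
    intro hk t ht
    have hFk := (hF.comp_continuousOn hk).locallyIntegrableOn (μ := volume) measurableSet_Ici
    have := intervalIntegral.integral_sub (intervalIntegrable_of_locallyIntegrableOn_Ici hFk ht)
      (intervalIntegrable_of_locallyIntegrableOn_Ici hc ht)
    simp only [Function.comp_apply] at this
    rw [this]
    ring
  constructor
  · rintro ⟨h1, h2⟩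
    exact ⟨h1, fun t ht => (h2 t ht).trans (hsplit h1 t ht)⟩
  · rintro ⟨h1, h2⟩
    exact ⟨h1, fun t ht => (h2 t ht).trans (hsplit h1 t ht).symm⟩

/-- A control is admissible as soon as the orbit equation has a continuous nonnegative subsolution `y`.
As `F` is increasing, the iterates of the integral operator starting from `y` increase; each of them is
again a subsolution, hence bounded by Grönwall's inequality, and their limit is the orbit. -/
theorem mem_admissible_of_subsolution {F : ℝ → ℝ} (hF : Continuous F) (hFm : MonotoneOn F (Ici 0))
    (hF0 : 0 ≤ F 0) {a b : ℝ} (ha : 0 ≤ a) (hlin : ∀ x, 0 ≤ x → F x ≤ b + a * x) {k₀ : ℝ}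
    {c y : ℝ → ℝ} (hc : LocallyIntegrableOn c (Ici 0))
    (hc0 : ∀ᵐ t ∂(volume.restrict (Ici (0 : ℝ))), 0 ≤ c t) (hy : ContinuousOn y (Ici 0))
    (hy0 : ∀ t, 0 ≤ t → 0 ≤ y t)
    (hsub : ∀ t, 0 ≤ t →
      y t ≤ k₀ + (∫ s in (0 : ℝ)..t, F (y s)) - ∫ s in (0 : ℝ)..t, c s) :
    c ∈ admissible F k₀ := by
  let T : (ℝ → ℝ) → ℝ → ℝ := fun x t =>
    k₀ + (∫ s in (0 : ℝ)..t, F (x s)) - ∫ s in (0 : ℝ)..t, c s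
  let S : Set (ℝ → ℝ) := {x | ContinuousOn x (Ici 0) ∧ ∀ t, 0 ≤ t → 0 ≤ x t ∧ x t ≤ T x t}
  have hloc : ∀ {x : ℝ → ℝ}, ContinuousOn x (Ici 0) → LocallyIntegrableOn (fun s => F (x s)) (Ici 0) :=
    fun hx => (hF.comp_continuousOn hx).locallyIntegrableOn (μ := volume) measurableSet_Ici
  have hTS : ∀ x ∈ S, T x ∈ S := by
    rintro x ⟨hx, hx0⟩
    have hTx : ContinuousOn (T x) (Ici 0) :=
      (continuousOn_const.add (continuousOn_Ici_integral (hloc hx))).sub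
        (continuousOn_Ici_integral hc)
    refine ⟨hTx, fun t ht => ⟨(hx0 t ht).1.trans (hx0 t ht).2, ?_⟩⟩
    have := intervalIntegral_mono_of_locallyIntegrableOn_Ici (hloc hx) (hloc hTx) ht
      fun s hs => hFm (hx0 s hs).1 ((hx0 s hs).1.trans (hx0 s hs).2) (hx0 s hs).2
    show k₀ + (∫ s in (0 : ℝ)..t, F (x s)) - _ ≤ k₀ + (∫ s in (0 : ℝ)..t, F (T x s)) - _
    linarith
  have hSE : ∀ x ∈ S, ∀ t, 0 ≤ t → x t ≤ gronwallBound k₀ a b t := by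
    rintro x ⟨hx, hx0⟩ t ht
    refine le_gronwallBound_of_le_integral ha hx (fun t ht => ?_) ht
    have h1 := (hx0 t ht).2
    have h2 := intervalIntegral_nonneg_of_ae_Ici hc0 le_rfl ht
    have h3 := intervalIntegral_mono_of_locallyIntegrableOn_Ici (g := fun s => b + a * x s)
      (hloc hx) ((continuousOn_const.add (continuousOn_const.mul hx)).locallyIntegrableOn
        measurableSet_Ici) ht fun s hs => hlin _ (hx0 s hs).1
    simp only [T] at h1
    linarith
  let X : ℕ → ℝ → ℝ := fun n => T^[n] y
  have hXS : ∀ n, X n ∈ S := by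
    intro n
    induction n with
    | zero => exact ⟨hy, fun t ht => ⟨hy0 t ht, hsub t ht⟩⟩
    | succ n ih =>
      simp only [X, Function.iterate_succ_apply'] at ih ⊢
      exact hTS _ ih
  have hXsucc : ∀ n, X (n + 1) = T (X n) := fun n => Function.iterate_succ_apply' _ _ _
  have hXm : ∀ t, 0 ≤ t → Monotone fun n => X n t := fun t ht => monotone_nat_of_le_succ fun n => by
    rw [hXsucc]; exact ((hXS n).2 t ht).2
  have hlim : ∀ t, 0 ≤ t → Tendsto (fun n => X n t) atTop (𝓝 (⨆ n, X n t)) := fun t ht =>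
    tendsto_atTop_ciSup (hXm t ht) ⟨gronwallBound k₀ a b t, by
      rintro _ ⟨n, rfl⟩; exact hSE _ (hXS n) t ht⟩
  let x : ℝ → ℝ := fun t => ⨆ n, X n t
  have hx0 : ∀ t, 0 ≤ t → 0 ≤ x t := fun t ht => ge_of_tendsto' (hlim t ht) fun n => ((hXS n).2 t ht).1
  have hFlim : ∀ t, 0 ≤ t → Tendsto (fun n => F (X n t)) atTop (𝓝 (F (x t))) := fun t ht =>
    (hF.tendsto _).comp (hlim t ht)
  have hEc : Continuous fun t => b + a * gronwallBound k₀ a b t :=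
    continuous_const.add (continuous_const.mul (continuous_iff_continuousAt.2 fun t =>
      (hasDerivAt_gronwallBound k₀ a b t).continuousAt))
  have hFb : ∀ n t, 0 ≤ t → ‖F (X n t)‖ ≤ b + a * gronwallBound k₀ a b t := by
    intro n t ht
    have h0 := ((hXS n).2 t ht).1
    rw [Real.norm_of_nonneg (hF0.trans (hFm self_mem_Ici h0 h0))]
    exact (hlin _ h0).trans (by gcongr; exact hSE _ (hXS n) t ht)
  have hI : ∀ {t : ℝ}, 0 ≤ t → ∀ s ∈ uIoc 0 t, 0 ≤ s := fun ht s hs => by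
    rw [uIoc_of_le ht] at hs; exact hs.1.le
  have hXae : ∀ n {t : ℝ}, 0 ≤ t →
      AEStronglyMeasurable (fun s => F (X n s)) (volume.restrict (uIoc 0 t)) := fun n t ht =>
    ((hF.comp_continuousOn (hXS n).1).mono fun s hs => hI ht s hs).aestronglyMeasurable
      measurableSet_uIoc
  have hxloc : LocallyIntegrableOn (fun s => F (x s)) (Ici 0) := by
    refine locallyIntegrableOn_Ici_of_intervalIntegrable fun t ht => ?_
    refine (hEc.intervalIntegrable 0 t).mono_fun' ?_ ?_
    · exact aestronglyMeasurable_of_tendsto_ae atTop (fun n => hXae n ht)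
        ((ae_restrict_iff' measurableSet_uIoc).2 (Eventually.of_forall fun s hs =>
          hFlim s (hI ht s hs)))
    · exact (ae_restrict_iff' measurableSet_uIoc).2 (Eventually.of_forall fun s hs =>
        le_of_tendsto' (hFlim s (hI ht s hs)).norm fun n => hFb n s (hI ht s hs))
  have hfix : ∀ t, 0 ≤ t → x t = T x t := by
    intro t ht
    have h1 : Tendsto (fun n => X (n + 1) t) atTop (𝓝 (x t)) :=
      (hlim t ht).comp (tendsto_add_atTop_nat 1)
    have h2 : Tendsto (fun n => ∫ s in (0 : ℝ)..t, F (X n s)) atTop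
        (𝓝 (∫ s in (0 : ℝ)..t, F (x s))) :=
      intervalIntegral.tendsto_integral_filter_of_dominated_convergence _
        (Eventually.of_forall fun n => hXae n ht)
        (Eventually.of_forall fun n => Eventually.of_forall fun s hs => hFb n s (hI ht s hs))
        (hEc.intervalIntegrable 0 t)
        (Eventually.of_forall fun s hs => hFlim s (hI ht s hs))
    refine tendsto_nhds_unique h1 ?_
    simp only [hXsucc]
    exact (h2.const_add k₀).sub_const _
  have hxc : ContinuousOn x (Ici 0) :=
    ((continuousOn_const.add (continuousOn_Ici_integral hxloc)).sub
      (continuousOn_Ici_integral hc)).congr hfix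
  exact ⟨hc, hc0, x, (isOrbit_iff hF hc).2 ⟨hxc, hfix⟩, hx0⟩

/-- Free disposal in time: a control whose accumulated consumption never exceeds that of an admissible
control is admissible, because the orbit of the latter is a subsolution for the former. -/
theorem mem_admissible_of_integral_le {F : ℝ → ℝ} (hF : Continuous F) (hFm : MonotoneOn F (Ici 0))
    (hF0 : 0 ≤ F 0) {a b : ℝ} (ha : 0 ≤ a) (hlin : ∀ x, 0 ≤ x → F x ≤ b + a * x) {k₀ : ℝ}
    {c d : ℝ → ℝ} (hd : d ∈ admissible F k₀) (hc : LocallyIntegrableOn c (Ici 0))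
    (hc0 : ∀ᵐ t ∂(volume.restrict (Ici (0 : ℝ))), 0 ≤ c t)
    (hle : ∀ t, 0 ≤ t → ∫ s in (0 : ℝ)..t, c s ≤ ∫ s in (0 : ℝ)..t, d s) :
    c ∈ admissible F k₀ := by
  obtain ⟨hdl, -, k, hk, hk0⟩ := hd
  obtain ⟨hkc, hke⟩ := (isOrbit_iff hF hdl).1 hk
  refine mem_admissible_of_subsolution hF hFm hF0 ha hlin hc hc0 hkc hk0 fun t ht => ?_
  have h1 := hle t ht
  have h2 := hke t ht
  linarith

/-- The initial capital and the accumulated production, which together dominate both the capital stock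
and the accumulated consumption, grow at most exponentially. -/
theorem integral_production_le {F : ℝ → ℝ} (hF : Continuous F) {a b : ℝ} (ha : 0 ≤ a)
    (hlin : ∀ x, 0 ≤ x → F x ≤ b + a * x) {k₀ : ℝ} {c k : ℝ → ℝ}
    (hc : LocallyIntegrableOn c (Ici 0))
    (hc0 : ∀ᵐ t ∂(volume.restrict (Ici (0 : ℝ))), 0 ≤ c t) (hk : IsOrbit F k₀ c k)
    (hk0 : ∀ t, 0 ≤ t → 0 ≤ k t) {t : ℝ} (ht : 0 ≤ t) :
    k₀ + ∫ s in (0 : ℝ)..t, F (k s) ≤ gronwallBound k₀ a b t := by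
  obtain ⟨hkc, hke⟩ := (isOrbit_iff hF hc).1 hk
  have hloc : LocallyIntegrableOn (fun s => F (k s)) (Ici 0) :=
    (hF.comp_continuousOn hkc).locallyIntegrableOn (μ := volume) measurableSet_Ici
  have hz : ContinuousOn (fun t => k₀ + ∫ s in (0 : ℝ)..t, F (k s)) (Ici 0) :=
    continuousOn_const.add (continuousOn_Ici_integral hloc)
  refine le_gronwallBound_of_le_integral ha hz (fun t ht => ?_) ht
  refine add_le_add le_rfl ?_
  refine intervalIntegral_mono_of_locallyIntegrableOn_Ici hloc
    ((continuousOn_const.add (continuousOn_const.mul hz)).locallyIntegrableOn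
        measurableSet_Ici) ht fun s hs => (hlin _ (hk0 s hs)).trans ?_
  refine add_le_add le_rfl (mul_le_mul_of_nonneg_left ?_ ha)
  have h1 := hke s hs
  have h2 := intervalIntegral_nonneg_of_ae_Ici hc0 le_rfl hs
  linarith

/-- If `∫₀ᵗ c` grows at most like `exp (a t)`, then `c` is integrable against `exp (-(a + ε) t)`, with a
bound on the integral that depends on `c` only through the growth constant `M`. -/
theorem integrableOn_exp_mul_of_integral_le {c : ℝ → ℝ} (hc : LocallyIntegrableOn c (Ici 0))
    (hc0 : ∀ᵐ t ∂(volume.restrict (Ici (0 : ℝ))), 0 ≤ c t) {M a ε : ℝ} (hε : 0 < ε)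
    (ha : 0 ≤ a) (hM : 0 ≤ M)
    (hle : ∀ t, 0 ≤ t → ∫ s in (0 : ℝ)..t, c s ≤ M * Real.exp (a * t)) :
    IntegrableOn (fun t => Real.exp (-(a + ε) * t) * c t) (Ici 0) ∧
      ∫ t in Ici (0 : ℝ), Real.exp (-(a + ε) * t) * c t
        ≤ M * Real.exp a * ∑' n : ℕ, Real.exp (-ε) ^ n := by
  have hsm : AEStronglyMeasurable (fun t => Real.exp (-(a + ε) * t) * c t)
      (volume.restrict (Ici 0)) :=
    (by fun_prop : Continuous fun t => Real.exp (-(a + ε) * t)).aestronglyMeasurable.mul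
      hc.aestronglyMeasurable
  have hnn : 0 ≤ᵐ[volume.restrict (Ici (0 : ℝ))] fun t => Real.exp (-(a + ε) * t) * c t := by
    filter_upwards [hc0] with t ht
    exact mul_nonneg (Real.exp_pos _).le ht
  have hq : Real.exp (-ε) < 1 := Real.exp_lt_one_iff.2 (by linarith)
  have hsum : Summable fun n : ℕ => M * Real.exp a * Real.exp (-ε) ^ n :=
    (summable_geometric_of_lt_one (Real.exp_pos _).le hq).mul_left _
  have hcover : Ici (0 : ℝ) ⊆ ⋃ n : ℕ, Ioc (n : ℝ) (n + 1) ∪ {(0 : ℝ)} := by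
    intro t ht
    rcases eq_or_lt_of_le (show (0 : ℝ) ≤ t from ht) with h | h
    · exact mem_iUnion.2 ⟨0, Or.inr h.symm⟩
    · have hpos : 0 < ⌈t⌉₊ := Nat.ceil_pos.2 h
      refine mem_iUnion.2 ⟨⌈t⌉₊ - 1, Or.inl ⟨?_, ?_⟩⟩
      · exact Nat.lt_ceil.1 (by omega)
      · have : ((⌈t⌉₊ - 1 : ℕ) : ℝ) + 1 = ⌈t⌉₊ := by
          rw [← Nat.cast_add_one, Nat.sub_add_cancel hpos]
        rw [this]
        exact Nat.le_ceil t
  have hpiece : ∀ n : ℕ, ∫⁻ t in Ioc (n : ℝ) (n + 1) ∪ {(0 : ℝ)},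
      ENNReal.ofReal (Real.exp (-(a + ε) * t) * c t)
        ≤ ENNReal.ofReal (M * Real.exp a * Real.exp (-ε) ^ n) := by
    intro n
    have hn : (0 : ℝ) ≤ n := n.cast_nonneg
    have hsubI : Ioc (n : ℝ) (n + 1) ⊆ Ici 0 := fun x hx => hn.trans hx.1.le
    have hcI : IntegrableOn c (Ioc (n : ℝ) (n + 1)) :=
      (hc.integrableOn_compact_subset (t := Icc (n : ℝ) (n + 1)) (fun x hx => hn.trans hx.1)
        isCompact_Icc).mono_set Ioc_subset_Icc_self
    have hc0I := ae_restrict_of_ae_restrict_of_subset hsubI hc0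
    have h1 : ∫⁻ t in Ioc (n : ℝ) (n + 1) ∪ {(0 : ℝ)},
        ENNReal.ofReal (Real.exp (-(a + ε) * t) * c t)
        ≤ ∫⁻ t in Ioc (n : ℝ) (n + 1), ENNReal.ofReal (Real.exp (-(a + ε) * t) * c t) := by
      refine (lintegral_union_le _ _ _).trans ?_
      simp
    have hcn : ∫ t in Ioc (n : ℝ) (n + 1), c t ≤ M * Real.exp (a * (n + 1)) := by
      rw [← intervalIntegral.integral_of_le (by linarith)]
      have hI := intervalIntegral.integral_add_adjacent_intervals
        (intervalIntegrable_of_locallyIntegrableOn_Ici hc hn)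
        ((intervalIntegrable_iff_integrableOn_Ioc_of_le (by linarith)).2 hcI)
      have h2 := intervalIntegral_nonneg_of_ae_Ici hc0 le_rfl hn
      have h3 := hle (n + 1) (by linarith)
      linarith
    refine h1.trans ?_
    calc ∫⁻ t in Ioc (n : ℝ) (n + 1), ENNReal.ofReal (Real.exp (-(a + ε) * t) * c t)
        ≤ ∫⁻ t in Ioc (n : ℝ) (n + 1), ENNReal.ofReal (Real.exp (-(a + ε) * n) * c t) := by
          refine lintegral_mono_ae ?_
          filter_upwards [ae_restrict_mem measurableSet_Ioc, hc0I] with t ht htc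
          refine ENNReal.ofReal_le_ofReal ?_
          refine mul_le_mul_of_nonneg_right (Real.exp_le_exp.2 ?_) htc
          nlinarith [ht.1]
      _ = ENNReal.ofReal (∫ t in Ioc (n : ℝ) (n + 1), Real.exp (-(a + ε) * n) * c t) := by
          rw [ofReal_integral_eq_lintegral_ofReal (hcI.const_mul _)]
          filter_upwards [hc0I] with t htc
          exact mul_nonneg (Real.exp_pos _).le htc
      _ ≤ ENNReal.ofReal (M * Real.exp a * Real.exp (-ε) ^ n) := by
          refine ENNReal.ofReal_le_ofReal ?_
          rw [integral_const_mul]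
          refine (mul_le_mul_of_nonneg_left hcn (Real.exp_pos _).le).trans_eq ?_
          rw [← Real.exp_nat_mul, mul_left_comm, mul_assoc, ← Real.exp_add, ← Real.exp_add]
          congr 2
          ring
  have key : ∫⁻ t in Ici (0 : ℝ), ENNReal.ofReal (Real.exp (-(a + ε) * t) * c t)
      ≤ ENNReal.ofReal (M * Real.exp a * ∑' n : ℕ, Real.exp (-ε) ^ n) := by
    refine (lintegral_mono_set hcover).trans ((lintegral_iUnion_le _ _).trans ?_)
    rw [← tsum_mul_left, ENNReal.ofReal_tsum_of_nonneg (fun n => by positivity) hsum]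
    exact ENNReal.tsum_le_tsum hpiece
  refine ⟨⟨hsm, ?_⟩, ?_⟩
  · rw [hasFiniteIntegral_iff_ofReal hnn]
    exact key.trans_lt ENNReal.ofReal_lt_top
  · rw [integral_eq_lintegral_of_nonneg_ae hnn hsm]
    exact ENNReal.toReal_le_of_le_ofReal
      (mul_nonneg (by positivity) (tsum_nonneg fun n => by positivity)) key

/-! ### Growth of the production function and of the utility -/

theorem exists_forall_sub_le_of_tendsto_deriv {f : ℝ → ℝ} {l a : ℝ}
    (hd : DifferentiableOn ℝ f (Ioi 0)) (ht : Tendsto (deriv f) atTop (𝓝 l)) (hla : l < a) :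
    ∃ N, 0 < N ∧ ∀ x, N ≤ x → f x - f N ≤ a * (x - N) := by
  obtain ⟨N, hN⟩ := eventually_atTop.1 ((ht.eventually_lt_const hla).and (eventually_gt_atTop 0))
  have hN0 : 0 < N := (hN N le_rfl).2
  have hd' : DifferentiableOn ℝ f (Ici N) := hd.mono fun x hx => hN0.trans_le hx
  refine ⟨N, hN0, fun x hx => ?_⟩
  refine (convex_Ici N).image_sub_le_mul_sub_of_deriv_le hd'.continuousOn
    (hd'.mono interior_subset) (fun y hy => (hN y ?_).1.le) N self_mem_Ici x hx hx
  exact interior_subset (s := Ici N) hy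

theorem exists_forall_le_add_mul_of_tendsto_deriv {f : ℝ → ℝ} {l a : ℝ}
    (hm : MonotoneOn f (Ici 0)) (hd : DifferentiableOn ℝ f (Ioi 0)) (h0 : f 0 = 0)
    (ht : Tendsto (deriv f) atTop (𝓝 l)) (hla : l < a) (ha : 0 ≤ a) :
    ∃ b, 0 ≤ b ∧ ∀ x, 0 ≤ x → f x ≤ b + a * x := by
  obtain ⟨N, hN, h⟩ := exists_forall_sub_le_of_tendsto_deriv hd ht hla
  refine ⟨f N, h0 ▸ hm self_mem_Ici hN.le hN.le, fun x hx => ?_⟩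
  rcases le_total N x with hNx | hNx
  · have := h x hNx
    have := mul_nonneg ha hN.le
    linarith
  · have := hm hx hN.le hNx
    have := mul_nonneg ha hx
    linarith

theorem concaveOn_le_mul_one_add_div {u : ℝ → ℝ} (hc : ConcaveOn ℝ (Ici 0) u)
    (hm : MonotoneOn u (Ici 0)) (h0 : u 0 = 0) {A c : ℝ} (hA : 0 < A) (hc0 : 0 ≤ c) :
    u c ≤ u A * (1 + c / A) := by
  have huA : 0 ≤ u A := h0 ▸ hm self_mem_Ici hA.le hA.le
  rcases le_total c A with h | h
  · refine (hm hc0 hA.le h).trans (le_mul_of_one_le_right huA ?_)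
    have : 0 ≤ c / A := by positivity
    linarith
  · have hcp : 0 < c := hA.trans_le h
    have hdiv : A / c ≤ 1 := (div_le_one hcp).2 h
    have h1 := hc.2 (show c ∈ Ici (0 : ℝ) from hc0) (self_mem_Ici (a := (0 : ℝ)))
      (show 0 ≤ A / c by positivity) (sub_nonneg.2 hdiv) (by ring)
    simp only [smul_eq_mul, h0, mul_zero, add_zero] at h1
    rw [div_mul_cancel₀ _ hcp.ne'] at h1
    have h2 : u c ≤ u A * (c / A) := by
      rw [← mul_div_assoc, le_div_iff₀ hA]
      rw [div_mul_eq_mul_div, div_le_iff₀ hcp] at h1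
      linarith
    linarith

/-- Decreasing increments: a concave function grows on `[x, x + h]` at least as fast, on average, as on
the later interval `[y, y + 1]`. -/
theorem concaveOn_mul_increment_le {u : ℝ → ℝ} (hc : ConcaveOn ℝ (Ici 0) u) {x y h : ℝ}
    (hx : 0 ≤ x) (hh : 0 < h) (hxy : x + h ≤ y) :
    h * (u (y + 1) - u y) ≤ u (x + h) - u x := by
  have hy : 0 < y := by linarith
  have h1 : (u (y + 1) - u y) / (y + 1 - y) ≤ (u (x + h) - u x) / (x + h - x) := by
    rcases eq_or_lt_of_le hxy with h' | h'
    · subst h'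
      exact hc.slope_anti_adjacent hx (show (0 : ℝ) ≤ _ by linarith) (by linarith) (by linarith)
    · exact (hc.slope_anti_adjacent (x := x + h) (y := y) (z := y + 1)
        (show (0 : ℝ) ≤ _ by linarith) (show (0 : ℝ) ≤ _ by linarith) h' (by linarith)).trans
        (hc.slope_anti_adjacent hx (show (0 : ℝ) ≤ _ by linarith) (by linarith) h')
  rw [add_sub_cancel_left, add_sub_cancel_left, div_one, le_div_iff₀ hh] at h1
  linarith

section Utility

variable {u : ℝ → ℝ} {L ρ : ℝ}

theorem IsUtility.nonneg (hu : IsUtility u L ρ) {x : ℝ} (hx : 0 ≤ x) : 0 ≤ u x :=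
  hu.map_zero ▸ hu.strictMonoOn.monotoneOn self_mem_Ici hx hx

theorem IsUtility.differentiableOn (hu : IsUtility u L ρ) : DifferentiableOn ℝ u (Ioi 0) :=
  hu.contDiffOn.differentiableOn (by norm_num)

theorem IsUtility.continuous_comp_max (hu : IsUtility u L ρ) : Continuous fun x => u (max x 0) :=
  hu.continuousOn.comp_continuous (by fun_prop) fun x => le_max_right x 0

/-- The discounted utility is at most an integrable function of time plus an arbitrarily small multiple
of the discounted consumption. For late times this compares `c` with `exp ((L + ε) t)` by concavity and
uses the growth condition; for early times it uses that `u` is sublinear. -/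
theorem IsUtility.exists_discounted_le (hu : IsUtility u L ρ) (hρ : 0 < ρ) (hL : 0 < L) {ε : ℝ}
    (hε : 0 < ε)
    (hg : Tendsto
      (fun t : ℝ => Real.exp (ε * t) * Real.exp (-ρ * t) * u (Real.exp ((L + ε) * t))) atTop (𝓝 0))
    {η : ℝ} (hη : 0 < η) :
    ∃ K, ∀ t, 0 ≤ t → ∀ c, 0 ≤ c → Real.exp (-ρ * t) * u c
      ≤ K * Real.exp (-ε * t) + η * (Real.exp (-(L + ε + ε) * t) * c) := by
  obtain ⟨T, hT⟩ := eventually_atTop.1 ((hg.eventually_le_const hη).and (eventually_ge_atTop 0))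
  have hη' : 0 < η * Real.exp (-(L + ε + ε) * T) := by positivity
  obtain ⟨M, hM0, hM⟩ := exists_forall_le_add_mul_of_tendsto_deriv hu.strictMonoOn.monotoneOn
    hu.differentiableOn hu.map_zero hu.tendsto_deriv_atTop hη' hη'.le
  refine ⟨M * Real.exp (ε * T) + η, fun t ht c hc => ?_⟩
  rcases le_total T t with h | h
  · have h1 := concaveOn_le_mul_one_add_div hu.strictConcaveOn.concaveOn
      hu.strictMonoOn.monotoneOn hu.map_zero (Real.exp_pos ((L + ε) * t)) hc
    have h2 : Real.exp (-ρ * t) * u (Real.exp ((L + ε) * t)) ≤ η * Real.exp (-ε * t) := by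
      have h3 := mul_le_mul_of_nonneg_right (hT t h).1 (Real.exp_pos (-ε * t)).le
      have h4 : Real.exp (ε * t) * Real.exp (-ε * t) = 1 := by
        rw [← Real.exp_add]; simp
      calc _ = Real.exp (ε * t) * Real.exp (-ε * t)
            * (Real.exp (-ρ * t) * u (Real.exp ((L + ε) * t))) := by rw [h4, one_mul]
        _ ≤ _ := by linarith
    have h5 : Real.exp (-(L + ε + ε) * t) = Real.exp (-ε * t) / Real.exp ((L + ε) * t) := by
      rw [← Real.exp_sub]; congr 1; ring
    calc Real.exp (-ρ * t) * u c
        ≤ Real.exp (-ρ * t) * (u (Real.exp ((L + ε) * t)) * (1 + c / Real.exp ((L + ε) * t))) := by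
          gcongr
      _ ≤ η * Real.exp (-ε * t) * (1 + c / Real.exp ((L + ε) * t)) := by
          rw [← mul_assoc]; gcongr
      _ = η * Real.exp (-ε * t) + η * (Real.exp (-(L + ε + ε) * t) * c) := by rw [h5]; ring
      _ ≤ _ := by
          gcongr
          have : 0 ≤ M * Real.exp (ε * T) := by positivity
          linarith
  · have h1 : Real.exp (-ρ * t) ≤ 1 := Real.exp_le_one_iff.2 (by nlinarith)
    have h2 : Real.exp (-(L + ε + ε) * T) ≤ Real.exp (-(L + ε + ε) * t) :=
      Real.exp_le_exp.2 (by nlinarith)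
    have h3 : (1 : ℝ) ≤ Real.exp (ε * T) * Real.exp (-ε * t) := by
      rw [← Real.exp_add]
      exact Real.one_le_exp (by nlinarith)
    calc Real.exp (-ρ * t) * u c ≤ u c := mul_le_of_le_one_left (hu.nonneg hc) h1
      _ ≤ M + η * Real.exp (-(L + ε + ε) * T) * c := hM c hc
      _ ≤ M * (Real.exp (ε * T) * Real.exp (-ε * t)) + η * Real.exp (-(L + ε + ε) * t) * c := by
          gcongr
          exact le_mul_of_one_le_right hM0 h3
      _ ≤ _ := by
          have : 0 ≤ η * Real.exp (-ε * t) := by positivity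
          linarith

theorem IsUtility.aestronglyMeasurable_comp (hu : IsUtility u L ρ) {μ : Measure ℝ} {c : ℝ → ℝ}
    (hc : AEStronglyMeasurable c μ) (hc0 : ∀ᵐ t ∂μ, 0 ≤ c t) :
    AEStronglyMeasurable (fun t => u (c t)) μ := by
  refine (hu.continuous_comp_max.comp_aestronglyMeasurable hc).congr ?_
  filter_upwards [hc0] with t ht
  rw [max_eq_left ht]

theorem IsUtility.integrableOn_discounted (hu : IsUtility u L ρ) (hρ : 0 < ρ) (hL : 0 < L) {ε : ℝ}
    (hε : 0 < ε)
    (hg : Tendsto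
      (fun t : ℝ => Real.exp (ε * t) * Real.exp (-ρ * t) * u (Real.exp ((L + ε) * t))) atTop (𝓝 0))
    {c : ℝ → ℝ} (hc : LocallyIntegrableOn c (Ici 0))
    (hc0 : ∀ᵐ t ∂(volume.restrict (Ici (0 : ℝ))), 0 ≤ c t)
    (hw : IntegrableOn (fun t => Real.exp (-(L + ε + ε) * t) * c t) (Ici 0)) :
    IntegrableOn (fun t => Real.exp (-ρ * t) * u (c t)) (Ici 0) := by
  obtain ⟨K, hK⟩ := hu.exists_discounted_le hρ hL hε hg one_pos
  have hexp : IntegrableOn (fun t => Real.exp (-ε * t)) (Ici 0) :=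
    (integrableOn_Ici_iff_integrableOn_Ioi).2 (integrableOn_exp_mul_Ioi (by linarith) 0)
  refine ((hexp.const_mul K).add (hw.const_mul 1)).mono' ?_ ?_
  · exact (by fun_prop : Continuous fun t => Real.exp (-ρ * t)).aestronglyMeasurable.mul
      (hu.aestronglyMeasurable_comp hc.aestronglyMeasurable hc0)
  · filter_upwards [hc0, ae_restrict_mem measurableSet_Ici] with t ht ht0
    rw [Real.norm_of_nonneg (mul_nonneg (Real.exp_pos _).le (hu.nonneg ht))]
    exact hK t ht0 _ ht

end Utility

section Production

variable {F : ℝ → ℝ} {L : ℝ}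

theorem IsProductionFunction.monotone (hF : IsProductionFunction F L) : Monotone F :=
  (strictMono_of_deriv_pos hF.deriv_pos).monotone

theorem IsProductionFunction.exists_le_add_mul (hF : IsProductionFunction F L) {ε : ℝ}
    (hε : 0 < ε) : ∃ b, 0 ≤ b ∧ ∀ x, 0 ≤ x → F x ≤ b + (L + ε) * x :=
  exists_forall_le_add_mul_of_tendsto_deriv (hF.monotone.monotoneOn _)
    (hF.contDiff.differentiable (by norm_num)).differentiableOn hF.map_zero hF.tendsto_deriv
    (by linarith) (by linarith [hF.limit_pos])

/-- The discounted total consumption is bounded uniformly over the admissible controls. -/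
theorem IsProductionFunction.exists_integral_exp_mul_le (hF : IsProductionFunction F L) {ε k₀ : ℝ}
    (hε : 0 < ε) (hk₀ : 0 ≤ k₀) :
    ∃ B, ∀ c ∈ admissible F k₀,
      IntegrableOn (fun t => Real.exp (-(L + ε + ε) * t) * c t) (Ici 0) ∧
      ∫ t in Ici (0 : ℝ), Real.exp (-(L + ε + ε) * t) * c t ≤ B := by
  obtain ⟨b, hb, hlin⟩ := hF.exists_le_add_mul hε
  have ha : 0 < L + ε := by linarith [hF.limit_pos]
  have hFc := hF.contDiff.continuous
  refine ⟨(k₀ + b / (L + ε)) * Real.exp (L + ε) * ∑' n : ℕ, Real.exp (-ε) ^ n, fun c hc => ?_⟩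
  obtain ⟨hcl, hc0, k, hk, hk0⟩ := hc
  refine integrableOn_exp_mul_of_integral_le (M := k₀ + b / (L + ε)) hcl hc0 hε ha.le
    (by positivity) fun t ht => ?_
  have h1 := (integral_production_le hFc ha.le hlin hcl hc0 hk hk0 ht).trans
    (gronwallBound_le_mul_exp ha hb)
  have h2 := ((isOrbit_iff hFc hcl).1 hk).2 t ht
  have h3 := hk0 t ht
  linarith

/-! ### Limits of admissible controls -/

/-- Along a subsequence of any sequence of admissible controls, the capital stocks converge almost
everywhere to some `κ ≥ 0`, and the accumulated consumptions to the quantity which the orbit equation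
assigns to `κ`. -/
theorem exists_subseq_orbit_tendsto (hF : IsProductionFunction F L) {k₀ : ℝ} (hk₀ : 0 ≤ k₀)
    {c : ℕ → ℝ → ℝ} (hc : ∀ n, c n ∈ admissible F k₀) :
    ∃ φ : ℕ → ℕ, StrictMono φ ∧ ∃ κ : ℝ → ℝ, LocallyIntegrableOn (fun t => F (κ t)) (Ici 0) ∧
      ∀ᵐ t ∂(volume.restrict (Ici (0 : ℝ))), 0 ≤ κ t ∧
        Tendsto (fun n => ∫ s in (0 : ℝ)..t, c (φ n) s) atTop
          (𝓝 (k₀ + (∫ s in (0 : ℝ)..t, F (κ s)) - κ t)) := by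
  obtain ⟨b, hb, hlin⟩ := hF.exists_le_add_mul one_pos
  have ha : 0 < L + 1 := by linarith [hF.limit_pos]
  have hFc := hF.contDiff.continuous
  have hF0 : ∀ x, 0 ≤ x → 0 ≤ F x := fun x hx => hF.map_zero ▸ hF.monotone hx
  choose hcl hc0 k hk hk0 using hc
  have hkc : ∀ n, ContinuousOn (k n) (Ici 0) := fun n => (hk n).continuousOn
  have hke : ∀ n t, 0 ≤ t →
      k n t = k₀ + (∫ s in (0 : ℝ)..t, F (k n s)) - ∫ s in (0 : ℝ)..t, c n s := fun n =>
    ((isOrbit_iff hFc (hcl n)).1 (hk n)).2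
  have hloc : ∀ n, LocallyIntegrableOn (fun s => F (k n s)) (Ici 0) := fun n =>
    (hFc.comp_continuousOn (hkc n)).locallyIntegrableOn (μ := volume) measurableSet_Ici
  have hFk0 : ∀ n, ∀ᵐ t ∂(volume.restrict (Ici (0 : ℝ))), 0 ≤ F (k n t) := fun n => by
    filter_upwards [ae_restrict_mem measurableSet_Ici] with t ht using hF0 _ (hk0 n t ht)
  have hmono : ∀ {f : ℝ → ℝ}, LocallyIntegrableOn f (Ici 0) →
      (∀ᵐ t ∂(volume.restrict (Ici (0 : ℝ))), 0 ≤ f t) →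
      Monotone fun t : ℝ => ∫ s in (0 : ℝ)..(max t 0), f s := by
    intro f hf hf0 s t hst
    have h0 : (0 : ℝ) ≤ max s 0 := le_max_right _ _
    have hle : max s 0 ≤ max t 0 := max_le_max_right 0 hst
    have h1 := intervalIntegrable_of_locallyIntegrableOn_Ici hf h0
    have h2 := intervalIntegrable_of_locallyIntegrableOn_Ici hf (h0.trans hle)
    have h3 := intervalIntegral.integral_interval_sub_left h2 h1
    have h4 := intervalIntegral_nonneg_of_ae_Ici hf0 h0 hle
    dsimp only
    linarith
  let E : ℝ → ℝ := fun t => gronwallBound k₀ (L + 1) b t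
  have hEc : Continuous E := continuous_iff_continuousAt.2 fun t =>
      (hasDerivAt_gronwallBound k₀ (L + 1) b t).continuousAt
  have hZE : ∀ n t, 0 ≤ t → k₀ + ∫ s in (0 : ℝ)..t, F (k n s) ≤ E t := fun n t ht =>
    integral_production_le hFc ha.le hlin (hcl n) (hc0 n) (hk n) (hk0 n) ht
  have hC0 : ∀ n t, 0 ≤ t → 0 ≤ ∫ s in (0 : ℝ)..t, c n s := fun n t ht =>
    intervalIntegral_nonneg_of_ae_Ici (hc0 n) le_rfl ht
  have hkE : ∀ n t, 0 ≤ t → k n t ≤ E t := fun n t ht => by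
    have := hZE n t ht
    have := hke n t ht
    have := hC0 n t ht
    linarith
  have hCE : ∀ n t, 0 ≤ t → ∫ s in (0 : ℝ)..t, c n s ≤ E t := fun n t ht => by
    have := hZE n t ht
    have := hke n t ht
    have := hk0 n t ht
    linarith
  obtain ⟨φ, hφ, Z, hZ⟩ := exists_subseq_ae_tendsto_of_monotone
    (f := fun n t => ∫ s in (0 : ℝ)..(max t 0), F (k n s)) (b := 0) (B := fun t => E (max t 0))
    (fun n => hmono (hloc n) (hFk0 n))
    (fun n t => intervalIntegral_nonneg_of_ae_Ici (hFk0 n) le_rfl (le_max_right _ _))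
    (fun n t => (le_add_of_nonneg_left hk₀).trans (hZE n _ (le_max_right _ _)))
  obtain ⟨ψ, hψ, C, hC⟩ := exists_subseq_ae_tendsto_of_monotone
    (f := fun n t => ∫ s in (0 : ℝ)..(max t 0), c (φ n) s) (b := 0) (B := fun t => E (max t 0))
    (fun n => hmono (hcl _) (hc0 _)) (fun n t => hC0 _ _ (le_max_right _ _))
    (fun n t => hCE _ _ (le_max_right _ _))
  let θ : ℕ → ℕ := φ ∘ ψ
  let κ : ℝ → ℝ := fun t => k₀ + Z t - C t
  have hlimC : ∀ᵐ t ∂(volume.restrict (Ici (0 : ℝ))),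
      Tendsto (fun n => ∫ s in (0 : ℝ)..t, c (θ n) s) atTop (𝓝 (C t)) := by
    filter_upwards [ae_restrict_of_ae hC, ae_restrict_mem measurableSet_Ici] with t h1 (h3 : 0 ≤ t)
    rwa [max_eq_left h3] at h1
  have hlimk : ∀ᵐ t ∂(volume.restrict (Ici (0 : ℝ))),
      Tendsto (fun n => k (θ n) t) atTop (𝓝 (κ t)) := by
    filter_upwards [ae_restrict_of_ae hZ, hlimC, ae_restrict_mem measurableSet_Ici]
      with t h1 h2 (h3 : 0 ≤ t)
    rw [max_eq_left h3] at h1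
    simp only [fun n => hke (θ n) t h3]
    exact ((h1.comp hψ.tendsto_atTop).const_add k₀).sub h2
  have hI : ∀ {t : ℝ}, 0 ≤ t → uIoc 0 t ⊆ Ici 0 := fun ht s hs => by
    rw [uIoc_of_le ht] at hs; exact hs.1.le
  have hdom : ∀ t, 0 ≤ t → ∀ n, ∀ᵐ s ∂(volume.restrict (uIoc 0 t)),
      ‖F (k (θ n) s)‖ ≤ b + (L + 1) * E s := fun t ht n => by
    filter_upwards [ae_restrict_mem measurableSet_uIoc] with s hs
    have hs0 := hI ht hs
    rw [Real.norm_of_nonneg (hF0 _ (hk0 _ s hs0))]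
    refine (hlin _ (hk0 _ s hs0)).trans ?_
    gcongr
    exact hkE _ s hs0
  have hmeas : ∀ t, 0 ≤ t → ∀ n,
      AEStronglyMeasurable (fun s => F (k (θ n) s)) (volume.restrict (uIoc 0 t)) := fun t ht n =>
    ((hFc.comp_continuousOn (hkc _)).mono (hI ht)).aestronglyMeasurable measurableSet_uIoc
  have hlimF : ∀ t, 0 ≤ t → ∀ᵐ s ∂(volume.restrict (uIoc 0 t)),
      Tendsto (fun n => F (k (θ n) s)) atTop (𝓝 (F (κ s))) := fun t ht => by
    filter_upwards [ae_restrict_of_ae_restrict_of_subset (hI ht) hlimk] with s hs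
    exact (hFc.tendsto _).comp hs
  have hbint : ∀ t, IntervalIntegrable (fun s => b + (L + 1) * E s) volume 0 t := fun t =>
    (continuous_const.add (continuous_const.mul hEc)).intervalIntegrable 0 t
  refine ⟨θ, hφ.comp hψ, κ, ?_, ?_⟩
  · refine locallyIntegrableOn_Ici_of_intervalIntegrable fun t ht => ?_
    refine (hbint t).mono_fun' ?_ ?_
    · exact aestronglyMeasurable_of_tendsto_ae atTop (hmeas t ht) (hlimF t ht)
    · filter_upwards [hlimF t ht, ae_all_iff.2 (hdom t ht)] with s h1 h2
      exact le_of_tendsto' h1.norm h2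
  · filter_upwards [hlimC, hlimk, ae_restrict_mem measurableSet_Ici] with t h1 h2 (h3 : 0 ≤ t)
    refine ⟨ge_of_tendsto' h2 fun n => hk0 _ t h3, ?_⟩
    have h4 : Tendsto (fun n => ∫ s in (0 : ℝ)..t, F (k (θ n) s)) atTop
        (𝓝 (∫ s in (0 : ℝ)..t, F (κ s))) :=
      intervalIntegral.tendsto_integral_filter_of_dominated_convergence _
        (Eventually.of_forall (hmeas t h3))
        (Eventually.of_forall fun n => (ae_restrict_iff' measurableSet_uIoc).1 (hdom t h3 n))
        (hbint t) ((ae_restrict_iff' measurableSet_uIoc).1 (hlimF t h3))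
    have h5 := (h4.const_add k₀).sub h2
    refine h5.congr fun n => ?_
    rw [hke (θ n) t h3]
    ring

theorem nonneg_of_ae_nonneg_Ici {y : ℝ → ℝ} (hy : ContinuousOn y (Ici 0))
    (h : ∀ᵐ t ∂(volume.restrict (Ici (0 : ℝ))), 0 ≤ y t) {t : ℝ} (ht : 0 ≤ t) : 0 ≤ y t := by
  by_contra hlt
  have h1 : ∀ᶠ s in 𝓝[>] t, y s < 0 :=
    (((hy t ht).mono fun s hs => ht.trans (le_of_lt hs)).tendsto).eventually_lt_const (not_le.1 hlt)
  obtain ⟨r, hr, hsub⟩ := mem_nhdsGT_iff_exists_Ioo_subset.1 h1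
  have h2 := ae_restrict_of_ae_restrict_of_subset (s := Ioo t r)
    (fun s hs => ht.trans hs.1.le) h
  have hne : NeBot (ae (volume.restrict (Ioo t r))) := by
    rw [ae_neBot, Ne, Measure.restrict_eq_zero, Real.volume_Ioo, ENNReal.ofReal_eq_zero, not_le]
    exact sub_pos.2 hr
  obtain ⟨s, hs1, hs2⟩ := (h2.and (ae_restrict_mem measurableSet_Ioo)).exists
  exact absurd (hsub hs2) (not_lt.2 hs1)

/-- A control whose accumulated consumption is at most the one the orbit equation assigns to the limit
stock `κ` is admissible. The stock `κ` itself may jump downwards; replacing its accumulated consumption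
by that of `c` gives a continuous subsolution. -/
theorem mem_admissible_of_integral_le_limit (hF : IsProductionFunction F L) {k₀ : ℝ}
    {c κ : ℝ → ℝ} (hc : LocallyIntegrableOn c (Ici 0))
    (hc0 : ∀ᵐ t ∂(volume.restrict (Ici (0 : ℝ))), 0 ≤ c t)
    (hκ : LocallyIntegrableOn (fun t => F (κ t)) (Ici 0))
    (hκc : ∀ᵐ t ∂(volume.restrict (Ici (0 : ℝ))), 0 ≤ κ t ∧
      ∫ s in (0 : ℝ)..t, c s ≤ k₀ + (∫ s in (0 : ℝ)..t, F (κ s)) - κ t) :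
    c ∈ admissible F k₀ := by
  obtain ⟨b, hb, hlin⟩ := hF.exists_le_add_mul one_pos
  have ha : 0 < L + 1 := by linarith [hF.limit_pos]
  have hFc := hF.contDiff.continuous
  let y : ℝ → ℝ := fun t => k₀ + (∫ s in (0 : ℝ)..t, F (κ s)) - ∫ s in (0 : ℝ)..t, c s
  have hy : ContinuousOn y (Ici 0) :=
    (continuousOn_const.add (continuousOn_Ici_integral hκ)).sub (continuousOn_Ici_integral hc)
  have hκy : ∀ᵐ t ∂(volume.restrict (Ici (0 : ℝ))), 0 ≤ κ t ∧ κ t ≤ y t := by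
    filter_upwards [hκc] with t ht
    exact ⟨ht.1, by simp only [y]; linarith [ht.2]⟩
  have hy0 : ∀ t, 0 ≤ t → 0 ≤ y t := fun t ht =>
    nonneg_of_ae_nonneg_Ici hy (hκy.mono fun s hs => hs.1.trans hs.2) ht
  refine mem_admissible_of_subsolution hFc (hF.monotone.monotoneOn _) hF.map_zero.ge ha.le hlin hc
    hc0 hy hy0 fun t ht => ?_
  have hyl : LocallyIntegrableOn (fun s => F (y s)) (Ici 0) :=
    (hFc.comp_continuousOn hy).locallyIntegrableOn (μ := volume) measurableSet_Ici
  have : ∫ s in (0 : ℝ)..t, F (κ s) ≤ ∫ s in (0 : ℝ)..t, F (y s) := by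
    refine intervalIntegral.integral_mono_ae_restrict ht
      (intervalIntegrable_of_locallyIntegrableOn_Ici hκ ht)
      (intervalIntegrable_of_locallyIntegrableOn_Ici hyl ht) ?_
    filter_upwards [ae_restrict_of_ae_restrict_of_subset (fun s hs => hs.1) hκy] with s hs
    exact hF.monotone hs.2
  simp only [y] at this ⊢
  linarith

end Production

/-! ### Existence of an optimal control -/

theorem convex_setOf_locallyIntegrableOn_nonneg :
    Convex ℝ {c : ℝ → ℝ | LocallyIntegrableOn c (Ici 0) ∧
      ∀ᵐ t ∂(volume.restrict (Ici (0 : ℝ))), 0 ≤ c t} := by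
  rintro c ⟨hcl, hc0⟩ d ⟨hdl, hd0⟩ α β hα hβ hαβ
  exact ⟨(hcl.smul α).add (hdl.smul β), convex_setOf_ae_nonneg hc0 hd0 hα hβ hαβ⟩

theorem convex_setOf_le_intertemporalUtility {u : ℝ → ℝ} {ρ : ℝ}
    (hu : ConcaveOn ℝ (Ici 0) u) {W : Set (ℝ → ℝ)} (hW : Convex ℝ W)
    (hW0 : ∀ c ∈ W, ∀ᵐ t ∂(volume.restrict (Ici (0 : ℝ))), 0 ≤ c t)
    (hWi : ∀ c ∈ W, IntegrableOn (fun t => Real.exp (-ρ * t) * u (c t)) (Ici 0)) (r : ℝ) :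
    Convex ℝ {c | c ∈ W ∧ r ≤ intertemporalUtility u ρ c} := by
  rintro c ⟨hc, hcr⟩ d ⟨hd, hdr⟩ α β hα hβ hαβ
  have hcd := hW hc hd hα hβ hαβ
  refine ⟨hcd, ?_⟩
  have h1 := (hWi c hc).const_mul α
  have h2 := (hWi d hd).const_mul β
  calc r = α * r + β * r := by rw [← add_mul, hαβ, one_mul]
    _ ≤ α * intertemporalUtility u ρ c + β * intertemporalUtility u ρ d := by gcongr
    _ = ∫ t in Ici (0 : ℝ),
        (α * (Real.exp (-ρ * t) * u (c t)) + β * (Real.exp (-ρ * t) * u (d t))) := by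
      rw [integral_add h1 h2, integral_const_mul, integral_const_mul]
      rfl
    _ ≤ intertemporalUtility u ρ (α • c + β • d) := by
      refine integral_mono_ae (h1.add h2) (hWi _ hcd) ?_
      filter_upwards [hW0 c hc, hW0 d hd] with t ht1 ht2
      have := mul_le_mul_of_nonneg_left (hu.2 ht1 ht2 hα hβ hαβ) (Real.exp_pos (-ρ * t)).le
      simp only [smul_eq_mul, Pi.add_apply, Pi.smul_apply] at this ⊢
      linarith

/-- A sequence of admissible controls whose utilities are at least `r n`, with `r n` increasing to `R`,
yields an admissible control of utility at least `R`. -/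
theorem exists_admissible_le_intertemporalUtility {F u : ℝ → ℝ} {L ρ : ℝ} (hρ : 0 < ρ)
    (hF : IsProductionFunction F L) (hu : IsUtility u L ρ) {k₀ : ℝ} (hk₀ : 0 ≤ k₀)
    {c : ℕ → ℝ → ℝ} (hc : ∀ n, c n ∈ admissible F k₀) {r : ℕ → ℝ} (hr : Monotone r) {R : ℝ}
    (hrR : Tendsto r atTop (𝓝 R)) (hrc : ∀ n, r n ≤ intertemporalUtility u ρ (c n)) :
    ∃ d ∈ admissible F k₀, R ≤ intertemporalUtility u ρ d ∧ ∀ t, 0 ≤ d t := by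
  obtain ⟨ε, hε, hg⟩ := hu.growth
  have hL := hF.limit_pos
  obtain ⟨B, hB⟩ := hF.exists_integral_exp_mul_le hε hk₀
  obtain ⟨φ, hφ, κ, hκ, hκlim⟩ := exists_subseq_orbit_tendsto hF hk₀ hc
  let w : ℝ → ℝ := fun t => Real.exp (-(L + ε + ε) * t)
  have hwc : Continuous w := by fun_prop
  obtain ⟨g, hgconv, h, hgh⟩ := exists_convexHull_ae_tendsto (f := fun n => c (φ n))
    (μ := volume.restrict (Ici (0 : ℝ))) (fun n => (hc (φ n)).2.1) (w := w)
    (fun t => Real.exp_pos _) hwc.aestronglyMeasurable (fun n => (hB _ (hc (φ n))).1)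
    (fun n => (hB _ (hc (φ n))).2)
  have hhull : ∀ {S : Set (ℝ → ℝ)}, Convex ℝ S → ∀ n, (∀ j, n ≤ j → c (φ j) ∈ S) → g n ∈ S :=
    fun hS n hn => convexHull_min (by rintro _ ⟨j, hj, rfl⟩; exact hn j hj) hS (hgconv n)
  let W : Set (ℝ → ℝ) := {c | LocallyIntegrableOn c (Ici 0) ∧
      ∀ᵐ t ∂(volume.restrict (Ici (0 : ℝ))), 0 ≤ c t} ∩
    {c | IntegrableOn (fun t => w t * c t) (Ici 0) ∧ ∫ t in Ici (0 : ℝ), w t * c t ≤ B}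
  have hW : Convex ℝ W := convex_setOf_locallyIntegrableOn_nonneg.inter
    (convex_setOf_integral_le w B)
  have hcW : ∀ n, c n ∈ W := fun n => ⟨⟨(hc n).1, (hc n).2.1⟩, hB _ (hc n)⟩
  have hgW : ∀ n, g n ∈ W := fun n => hhull hW n fun j _ => hcW _
  have hWi : ∀ c ∈ W, IntegrableOn (fun t => Real.exp (-ρ * t) * u (c t)) (Ici 0) :=
    fun c hc => hu.integrableOn_discounted hρ hL hε hg hc.1.1 hc.1.2 hc.2.1
  have hgU : ∀ n, r n ≤ intertemporalUtility u ρ (g n) := fun n =>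
    (hhull (convex_setOf_le_intertemporalUtility hu.strictConcaveOn.concaveOn hW
      (fun c hc => hc.1.2) hWi (r n)) n fun j hj =>
        ⟨hcW _, (hr (hj.trans (hφ.id_le j))).trans (hrc _)⟩).2
  have hg0 : ∀ᵐ t ∂(volume.restrict (Ici (0 : ℝ))), ∀ n, 0 ≤ g n t :=
    ae_all_iff.2 fun n => (hgW n).1.2
  -- `h` is nonnegative only almost everywhere
  let d : ℝ → ℝ := fun t => max (h t) 0
  have hgd : ∀ᵐ t ∂(volume.restrict (Ici (0 : ℝ))), Tendsto (fun n => g n t) atTop (𝓝 (d t)) := by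
    filter_upwards [hgh, hg0] with t h1 h2
    simpa only [d, max_eq_left (ge_of_tendsto' h1 h2)] using h1
  have hd0 : ∀ t, 0 ≤ d t := fun t => le_max_right _ _
  have hwd := (integrable_and_integral_le_of_tendsto (μ := volume.restrict (Ici (0 : ℝ)))
    (h := fun n t => w t * g n t) (g := fun t => w t * d t) (r := fun _ => B) (R := B)
    (fun n => (hgW n).2.1)
    (fun n => (hgW n).1.2.mono fun t ht => mul_nonneg (Real.exp_pos _).le ht)
    (fun n => (hgW n).2.2) tendsto_const_nhds
    (hgd.mono fun t ht => ht.const_mul _))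
  have hdl : LocallyIntegrableOn d (Ici 0) := by
    have h1 : LocallyIntegrableOn (fun t => w t * d t) (Ici 0) :=
      IntegrableOn.locallyIntegrableOn hwd.1
    have h2 := h1.continuousOn_mul (g := fun t => (w t)⁻¹)
      (hwc.inv₀ fun t => (Real.exp_pos _).ne').continuousOn isClosed_Ici.isLocallyClosed
    refine h2.congr ?_
    refine Eventually.of_forall fun t => ?_
    simp only [w]
    rw [inv_mul_cancel_left₀ (Real.exp_pos _).ne']
  have hd0' : ∀ᵐ t ∂(volume.restrict (Ici (0 : ℝ))), 0 ≤ d t := Eventually.of_forall hd0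
  have hdi := hu.integrableOn_discounted hρ hL hε hg hdl hd0' hwd.1
  refine ⟨d, mem_admissible_of_integral_le_limit hF hdl hd0' hκ ?_, ?_, hd0⟩
  -- the bound on the accumulated consumption is a convex constraint, so it passes from the tails of
  -- `c ∘ φ` to `g`, and by Fatou's lemma to `d`
  · filter_upwards [hκlim, ae_restrict_mem measurableSet_Ici] with t ⟨hκ0, hlim⟩ (ht : 0 ≤ t)
    refine ⟨hκ0, le_of_forall_pos_le_add fun δ hδ => ?_⟩
    obtain ⟨N, hN⟩ := eventually_atTop.1 (hlim.eventually_le_const (lt_add_of_pos_right _ hδ))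
    have hsub : Ioc 0 t ⊆ Ici (0 : ℝ) := fun s hs => hs.1.le
    have hgi : ∀ n, N ≤ n → IntegrableOn (g n) (Ioc 0 t) ∧
        ∫ s in Ioc 0 t, g n s ≤ k₀ + (∫ s in (0 : ℝ)..t, F (κ s)) - κ t + δ := by
      intro n hn
      have hmem := hhull (convex_setOf_integral_le (μ := volume.restrict (Ioc 0 t)) (fun _ => 1)
        (k₀ + (∫ s in (0 : ℝ)..t, F (κ s)) - κ t + δ)) n fun j hj => by
          have h1 := intervalIntegrable_of_locallyIntegrableOn_Ici (hc (φ j)).1 ht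
          have h2 := hN j (hn.trans hj)
          rw [intervalIntegral.integral_of_le ht] at h2
          rw [intervalIntegrable_iff_integrableOn_Ioc_of_le ht] at h1
          show Integrable (fun s => 1 * c (φ j) s) (volume.restrict (Ioc 0 t)) ∧
            ∫ s in Ioc 0 t, 1 * c (φ j) s ≤ _
          simp only [one_mul]
          exact ⟨h1, h2⟩
      have h1 : Integrable (fun s => 1 * g n s) (volume.restrict (Ioc 0 t)) ∧
        ∫ s in Ioc 0 t, 1 * g n s ≤ _ := hmem
      simp only [one_mul] at h1
      exact h1
    rw [intervalIntegral.integral_of_le ht]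
    refine (integrable_and_integral_le_of_tendsto (μ := volume.restrict (Ioc 0 t))
      (h := fun n => g (n + N)) (r := fun _ => _) (fun n => (hgi _ (Nat.le_add_left _ _)).1)
      (fun n => ae_restrict_of_ae_restrict_of_subset hsub (hgW _).1.2)
      (fun n => (hgi _ (Nat.le_add_left _ _)).2) tendsto_const_nhds ?_).2
    filter_upwards [ae_restrict_of_ae_restrict_of_subset hsub hgd] with s hs
    exact (tendsto_add_atTop_iff_nat N).2 hs
  · -- reverse Fatou, with the integrable majorant of `exists_discounted_le` and `η → 0`
    have hη : ∀ η, 0 < η → R ≤ intertemporalUtility u ρ d + η * B := by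
      intro η hη
      obtain ⟨K, hK⟩ := hu.exists_discounted_le hρ hL hε hg hη
      have hexp : IntegrableOn (fun t => K * Real.exp (-ε * t)) (Ici 0) :=
        ((integrableOn_Ici_iff_integrableOn_Ioi).2
          (integrableOn_exp_mul_Ioi (by linarith) 0)).const_mul K
      have hint : ∀ e : ℝ → ℝ, IntegrableOn (fun t => w t * e t) (Ici 0) →
          IntegrableOn (fun t => Real.exp (-ρ * t) * u (e t)) (Ici 0) →
          ∫ t in Ici (0 : ℝ), (K * Real.exp (-ε * t) + η * (w t * e t)
            - Real.exp (-ρ * t) * u (e t)) = (∫ t in Ici (0 : ℝ), K * Real.exp (-ε * t))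
            + η * (∫ t in Ici (0 : ℝ), w t * e t) - intertemporalUtility u ρ e := by
        intro e h1 h2
        rw [integral_sub (by exact hexp.add (h1.const_mul η)) h2,
          integral_add hexp (h1.const_mul η), integral_const_mul η]
        rfl
      have hfat := (integrable_and_integral_le_of_tendsto (μ := volume.restrict (Ici (0 : ℝ)))
        (h := fun n t => K * Real.exp (-ε * t) + η * (w t * g n t)
            - Real.exp (-ρ * t) * u (g n t))
        (g := fun t => K * Real.exp (-ε * t) + η * (w t * d t) - Real.exp (-ρ * t) * u (d t))
        (r := fun n => (∫ t in Ici (0 : ℝ), K * Real.exp (-ε * t)) + η * B - r n)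
        (fun n => (hexp.add ((hgW n).2.1.const_mul η)).sub (hWi _ (hgW n))) ?_ ?_
        (hrR.const_sub _) ?_).2
      · rw [hint d hwd.1 hdi] at hfat
        have : 0 ≤ ∫ t in Ici (0 : ℝ), w t * d t :=
          integral_nonneg fun t => mul_nonneg (Real.exp_pos _).le (hd0 t)
        have := mul_nonneg hη.le this
        linarith
      · intro n
        filter_upwards [hg0, ae_restrict_mem measurableSet_Ici] with t h1 h2
        exact sub_nonneg.2 (hK t h2 _ (h1 n))
      · intro n
        rw [hint (g n) (hgW n).2.1 (hWi _ (hgW n))]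
        have := mul_le_mul_of_nonneg_left (hgW n).2.2 hη.le
        have := hgU n
        linarith
      · filter_upwards [hgd, hg0] with t h1 h2
        refine ((h1.const_mul _).const_mul _ |>.const_add _).sub (Tendsto.const_mul _ ?_)
        have := (hu.continuous_comp_max.tendsto (d t)).comp h1
        simpa only [Function.comp_def, max_eq_left (hd0 t), fun n => max_eq_left (h2 n)] using this
    have hlim : Tendsto (fun η : ℝ => intertemporalUtility u ρ d + η * B) (𝓝[>] 0)
        (𝓝 (intertemporalUtility u ρ d + 0 * B)) :=
      ((continuous_const.add (continuous_id.mul continuous_const)).tendsto 0).mono_left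
        nhdsWithin_le_nhds
    rw [zero_mul, add_zero] at hlim
    exact ge_of_tendsto hlim (eventually_mem_nhdsWithin.mono hη)

/-! ### Local boundedness of optimal controls -/

/-- An optimal control is essentially bounded on bounded intervals: shifting a small amount of
consumption from the times where it is very large to later times would increase the utility. -/
theorem exists_ae_le_of_forall_intertemporalUtility_le {F u : ℝ → ℝ} {L ρ : ℝ} (hρ : 0 < ρ)
    (hF : IsProductionFunction F L) (hu : IsUtility u L ρ) {k₀ : ℝ}
    (hint : ∀ c ∈ admissible F k₀,
      IntegrableOn (fun t => Real.exp (-ρ * t) * u (c t)) (Ici 0))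
    {c : ℝ → ℝ} (hc : c ∈ admissible F k₀)
    (hopt : ∀ d ∈ admissible F k₀, intertemporalUtility u ρ d ≤ intertemporalUtility u ρ c)
    {T : ℝ} (hT : 0 < T) : ∃ N, ∀ᵐ t ∂(volume.restrict (Ioc 0 T)), c t ≤ N := by
  obtain ⟨b, hb, hlin⟩ := hF.exists_le_add_mul one_pos
  have ha : 0 < L + 1 := by linarith [hF.limit_pos]
  have hcl := hc.1
  have hc0 := hc.2.1
  have hsub1 : Ioc 0 T ⊆ Ici (0 : ℝ) := fun s hs => hs.1.le
  have hsub2 : Ioc T (T + 1) ⊆ Ici (0 : ℝ) := fun s hs => hT.le.trans hs.1.le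
  have hcT : IntegrableOn c (Ioc 0 T) :=
    (intervalIntegrable_iff_integrableOn_Ioc_of_le hT.le).1
      (intervalIntegrable_of_locallyIntegrableOn_Ici hcl hT.le)
  have hc01 := ae_restrict_of_ae_restrict_of_subset hsub1 hc0
  have hc02 := ae_restrict_of_ae_restrict_of_subset hsub2 hc0
  let D : ℝ := ∫ t in Ioc 0 T, c t
  have hD : 0 ≤ D := integral_nonneg_of_ae hc01
  -- a lower bound for the gain per additional unit of consumption at the rate `x`, as long as the
  -- addition is at most `D + 1`
  let s : ℝ → ℝ := fun x => u (x + (D + 1) + 1) - u (x + (D + 1))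
  have hs0 : ∀ x, 0 ≤ x → 0 < s x := fun x hx =>
    sub_pos.2 (hu.strictMonoOn (show (0 : ℝ) ≤ _ by linarith) (show (0 : ℝ) ≤ _ by linarith)
      (by linarith))
  have hs1 : ∀ x, 0 ≤ x → s x ≤ u 1 := fun x hx => by
    have := concaveOn_mul_increment_le hu.strictConcaveOn.concaveOn (x := 0) (h := 1)
      (y := x + (D + 1)) le_rfl one_pos (by linarith)
    rw [one_mul, zero_add, hu.map_zero, sub_zero] at this
    exact this
  have hsc : Continuous fun x => s (max x 0) := by
    refine Continuous.sub ?_ ?_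
    · exact hu.continuousOn.comp_continuous (by fun_prop) fun x =>
        show (0 : ℝ) ≤ _ by have := le_max_right x 0; linarith
    · exact hu.continuousOn.comp_continuous (by fun_prop) fun x =>
        show (0 : ℝ) ≤ _ by have := le_max_right x 0; linarith
  have hsi : IntegrableOn (fun t => Real.exp (-ρ * t) * s (c t)) (Ioc T (T + 1)) := by
    refine Integrable.mono' (g := fun _ => u 1) (integrable_const _) ?_ ?_
    · refine (by fun_prop : Continuous fun t => Real.exp (-ρ * t)).aestronglyMeasurable.mul ?_
      refine (hsc.comp_aestronglyMeasurable
        (hcl.aestronglyMeasurable.mono_measure (Measure.restrict_mono hsub2 le_rfl))).congr ?_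
      filter_upwards [hc02] with t ht
      rw [max_eq_left ht]
    · filter_upwards [hc02, ae_restrict_mem measurableSet_Ioc] with t ht ht'
      have h1 : Real.exp (-ρ * t) ≤ 1 := Real.exp_le_one_iff.2 (by nlinarith [ht'.1])
      rw [Real.norm_of_nonneg (mul_nonneg (Real.exp_pos _).le (hs0 _ ht).le)]
      exact (mul_le_of_le_one_left (hs0 _ ht).le h1).trans (hs1 _ ht)
  let q : ℝ := ∫ t in Ioc T (T + 1), Real.exp (-ρ * t) * s (c t)
  have hq : 0 < q := by
    refine (integral_pos_iff_support_of_nonneg_ae ?_ hsi).2 ?_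
    · filter_upwards [hc02] with t ht using mul_nonneg (Real.exp_pos _).le (hs0 _ ht).le
    · have h1 : Function.support (fun t => Real.exp (-ρ * t) * s (c t))
          =ᵐ[volume.restrict (Ioc T (T + 1))] univ := by
        filter_upwards [hc02] with t ht
        exact eq_true (mul_pos (Real.exp_pos _) (hs0 _ ht)).ne'
      rw [measure_congr h1]
      simp
  obtain ⟨N, hN0, hN⟩ := exists_forall_sub_le_of_tendsto_deriv hu.differentiableOn
    hu.tendsto_deriv_atTop (half_pos hq)
  refine ⟨N, ?_⟩
  by_contra hcon
  let e : ℝ → ℝ := fun t => max (c t - N) 0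
  have he0 : ∀ t, 0 ≤ e t := fun t => le_max_right _ _
  have hei : IntegrableOn e (Ioc 0 T) := (hcT.sub (integrable_const N)).pos_part
  let δ : ℝ := ∫ t in Ioc 0 T, e t
  have hδ : 0 < δ := by
    refine lt_of_le_of_ne (integral_nonneg he0) fun h => hcon ?_
    have := (integral_eq_zero_iff_of_nonneg he0 hei).1 h.symm
    filter_upwards [this] with t ht
    have : c t - N ≤ e t := le_max_left _ _
    rw [ht] at this
    simpa using this
  have hδD : δ ≤ D := by
    refine integral_mono_ae hei hcT ?_
    filter_upwards [hc01] with t ht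
    exact max_le (by linarith) ht
  -- cut the consumption at `N` on `(0, T]`, and spend what is saved uniformly on `(T, T + 1]`
  let d : ℝ → ℝ := fun t =>
    c t - (Ioc 0 T).indicator e t + (Ioc T (T + 1)).indicator (fun _ => δ) t
  have hei' : Integrable ((Ioc 0 T).indicator e) := hei.integrable_indicator measurableSet_Ioc
  have hδi : Integrable ((Ioc T (T + 1)).indicator fun _ : ℝ => δ) :=
    (integrableOn_const (by simp)).integrable_indicator measurableSet_Ioc
  have hdl : LocallyIntegrableOn d (Ici 0) :=
    (hcl.sub (hei'.locallyIntegrable.locallyIntegrableOn _)).add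
      (hδi.locallyIntegrable.locallyIntegrableOn _)
  have hd1 : ∀ t ∈ Ioc 0 T, d t = min (c t) N := by
    intro t ht
    have h2 : t ∉ Ioc T (T + 1) := fun h => absurd h.1 (not_lt.2 ht.2)
    simp only [d, indicator_of_mem ht, indicator_of_notMem h2, e]
    rcases le_total (c t) N with h | h
    · rw [max_eq_right (by linarith), min_eq_left h]; ring
    · rw [max_eq_left (by linarith), min_eq_right h]; ring
  have hd2 : ∀ t ∈ Ioc T (T + 1), d t = c t + δ := by
    intro t ht
    have h2 : t ∉ Ioc 0 T := fun h => absurd ht.1 (not_lt.2 h.2)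
    simp only [d, indicator_of_mem ht, indicator_of_notMem h2]
    ring
  have hd3 : ∀ t, t ∉ Ioc 0 T → t ∉ Ioc T (T + 1) → d t = c t := by
    intro t h1 h2
    simp only [d, indicator_of_notMem h1, indicator_of_notMem h2]
    ring
  have hd0 : ∀ᵐ t ∂(volume.restrict (Ici (0 : ℝ))), 0 ≤ d t := by
    filter_upwards [hc0] with t ht
    by_cases h1 : t ∈ Ioc 0 T
    · rw [hd1 t h1]; exact le_min ht hN0.le
    · by_cases h2 : t ∈ Ioc T (T + 1)
      · rw [hd2 t h2]; positivity
      · rw [hd3 t h1 h2]; exact ht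
  have hdc : ∀ t, 0 ≤ t → ∫ r in (0 : ℝ)..t, d r ≤ ∫ r in (0 : ℝ)..t, c r := by
    intro t ht
    have hci := intervalIntegrable_of_locallyIntegrableOn_Ici hcl ht
    have h1 : ∫ r in (0 : ℝ)..t, d r = (∫ r in (0 : ℝ)..t, c r)
        - (∫ r in (0 : ℝ)..t, (Ioc 0 T).indicator e r)
        + ∫ r in (0 : ℝ)..t, (Ioc T (T + 1)).indicator (fun _ => δ) r := by
      rw [← intervalIntegral.integral_sub hci hei'.intervalIntegrable,
        ← intervalIntegral.integral_add (hci.sub hei'.intervalIntegrable) hδi.intervalIntegrable]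
    have h2 : ∫ r in (0 : ℝ)..t, (Ioc T (T + 1)).indicator (fun _ => δ) r
        ≤ ∫ r in (0 : ℝ)..t, (Ioc 0 T).indicator e r := by
      rw [intervalIntegral.integral_of_le ht, intervalIntegral.integral_of_le ht,
        setIntegral_indicator measurableSet_Ioc, setIntegral_indicator measurableSet_Ioc]
      rcases le_total t T with h | h
      · have hempty : Ioc 0 t ∩ Ioc T (T + 1) = ∅ := by
          ext x
          simp only [mem_inter_iff, mem_Ioc, mem_empty_iff_false, iff_false]
          rintro ⟨⟨-, hx1⟩, hx2, -⟩
          linarith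
        rw [hempty, Measure.restrict_empty, integral_zero_measure]
        exact integral_nonneg he0
      · have heq : Ioc 0 t ∩ Ioc 0 T = Ioc 0 T := inter_eq_right.2 (Ioc_subset_Ioc_right h)
        rw [heq, setIntegral_const, smul_eq_mul]
        refine mul_le_of_le_one_left hδ.le ?_
        calc volume.real (Ioc 0 t ∩ Ioc T (T + 1)) ≤ volume.real (Ioc T (T + 1)) :=
              measureReal_mono inter_subset_right (by simp)
          _ = 1 := by simp
    linarith
  have hd : d ∈ admissible F k₀ := mem_admissible_of_integral_le hF.contDiff.continuous
    (hF.monotone.monotoneOn _) hF.map_zero.ge ha.le hlin hc hdl hd0 hdc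
  have hpt : ∀ᵐ t ∂(volume.restrict (Ici (0 : ℝ))),
      Real.exp (-ρ * t) * u (c t) - (Ioc 0 T).indicator (fun t => q / 2 * e t) t
        + (Ioc T (T + 1)).indicator (fun t => δ * (Real.exp (-ρ * t) * s (c t))) t
        ≤ Real.exp (-ρ * t) * u (d t) := by
    filter_upwards [hc0, ae_restrict_mem measurableSet_Ici] with t ht (ht0 : 0 ≤ t)
    have hexp : Real.exp (-ρ * t) ≤ 1 := Real.exp_le_one_iff.2 (by nlinarith)
    have hexp0 := Real.exp_pos (-ρ * t)
    by_cases h1 : t ∈ Ioc 0 T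
    · have h2 : t ∉ Ioc T (T + 1) := fun h => absurd h.1 (not_lt.2 h1.2)
      rw [hd1 t h1, indicator_of_mem h1, indicator_of_notMem h2]
      have h3 : u (c t) - u (min (c t) N) ≤ q / 2 * e t := by
        rcases le_total (c t) N with h | h
        · rw [min_eq_left h, sub_self]
          exact mul_nonneg (half_pos hq).le (he0 t)
        · rw [min_eq_right h]
          exact (hN _ h).trans (mul_le_mul_of_nonneg_left (le_max_left _ _) (half_pos hq).le)
      have h4 : Real.exp (-ρ * t) * (q / 2 * e t) ≤ q / 2 * e t :=
        mul_le_of_le_one_left (mul_nonneg (half_pos hq).le (he0 t)) hexp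
      have h5 := mul_le_mul_of_nonneg_left h3 hexp0.le
      linarith
    · by_cases h2 : t ∈ Ioc T (T + 1)
      · rw [hd2 t h2, indicator_of_notMem h1, indicator_of_mem h2]
        have h3 := concaveOn_mul_increment_le hu.strictConcaveOn.concaveOn ht hδ
          (y := c t + (D + 1)) (by linarith)
        have h4 := mul_le_mul_of_nonneg_left h3 hexp0.le
        simp only [s]
        linarith
      · rw [hd3 t h1 h2, indicator_of_notMem h1, indicator_of_notMem h2]
        linarith
  have hUc := hint c hc
  have hi1 : Integrable ((Ioc 0 T).indicator fun t => q / 2 * e t)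
      (volume.restrict (Ici (0 : ℝ))) :=
    (IntegrableOn.integrable_indicator (hei.const_mul _) measurableSet_Ioc).restrict
  have hi2 : Integrable ((Ioc T (T + 1)).indicator fun t => δ * (Real.exp (-ρ * t) * s (c t)))
      (volume.restrict (Ici (0 : ℝ))) :=
    (IntegrableOn.integrable_indicator (hsi.const_mul _) measurableSet_Ioc).restrict
  have hfin := integral_mono_ae ((hUc.sub hi1).add hi2) (hint d hd) hpt
  simp only [Pi.add_apply, Pi.sub_apply] at hfin
  rw [integral_add (by exact hUc.sub hi1) hi2, integral_sub hUc hi1,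
    setIntegral_indicator measurableSet_Ioc, setIntegral_indicator measurableSet_Ioc,
    inter_eq_right.2 hsub1, inter_eq_right.2 hsub2, integral_const_mul, integral_const_mul] at hfin
  have hle := hopt d hd
  unfold intertemporalUtility at hle
  change _ - q / 2 * δ + δ * q ≤ _ at hfin
  have := mul_pos hδ hq
  linarith

end OptimalGrowth

theorem mainTheorem1 (F u : ℝ → ℝ) (L ρ : ℝ) (hρ : 0 < ρ)
    (hF : OptimalGrowth.IsProductionFunction F L) (hu : OptimalGrowth.IsUtility u L ρ)
    (k₀ : ℝ) (hk₀ : 0 ≤ k₀) :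
    (∀ c ∈ OptimalGrowth.admissible F k₀,
      IntegrableOn (fun t => Real.exp (-ρ * t) * u (c t)) (Ici 0) volume) ∧
    BddAbove (OptimalGrowth.intertemporalUtility u ρ '' OptimalGrowth.admissible F k₀) ∧
    ∃ cstar ∈ OptimalGrowth.admissible F k₀,
      OptimalGrowth.intertemporalUtility u ρ cstar = OptimalGrowth.valueFunction F u ρ k₀ ∧
      (∀ t, 0 ≤ t → 0 ≤ cstar t) ∧
      (∀ T : ℝ, 0 < T → MemLp cstar ⊤ (volume.restrict (Icc 0 T))) := by
  obtain ⟨ε, hε, hg⟩ := hu.growth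
  have hL := hF.limit_pos
  obtain ⟨B, hB⟩ := hF.exists_integral_exp_mul_le hε hk₀
  have hint : ∀ c ∈ OptimalGrowth.admissible F k₀,
      IntegrableOn (fun t => Real.exp (-ρ * t) * u (c t)) (Ici 0) volume := fun c hc =>
    hu.integrableOn_discounted hρ hL hε hg hc.1 hc.2.1 (hB c hc).1
  have hbdd : BddAbove
      (OptimalGrowth.intertemporalUtility u ρ '' OptimalGrowth.admissible F k₀) := by
    obtain ⟨K, hK⟩ := hu.exists_discounted_le hρ hL hε hg one_pos
    have hexp : IntegrableOn (fun t => K * Real.exp (-ε * t)) (Ici 0) :=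
      ((integrableOn_Ici_iff_integrableOn_Ioi).2
        (integrableOn_exp_mul_Ioi (by linarith) 0)).const_mul K
    refine ⟨(∫ t in Ici (0 : ℝ), K * Real.exp (-ε * t)) + B, ?_⟩
    rintro _ ⟨c, hc, rfl⟩
    refine le_trans ?_ (add_le_add le_rfl (hB c hc).2)
    rw [← integral_add hexp (hB c hc).1]
    refine integral_mono_ae (hint c hc) (hexp.add (hB c hc).1) ?_
    filter_upwards [hc.2.1, ae_restrict_mem measurableSet_Ici] with t h1 h2
    simpa using hK t h2 _ h1
  refine ⟨hint, hbdd, ?_⟩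
  have hne : (OptimalGrowth.intertemporalUtility u ρ '' OptimalGrowth.admissible F k₀).Nonempty := by
    obtain ⟨b, hb, hlin⟩ := hF.exists_le_add_mul one_pos
    refine ⟨_, fun _ => 0, ?_, rfl⟩
    refine OptimalGrowth.mem_admissible_of_subsolution (y := fun _ => 0) hF.contDiff.continuous
      (hF.monotone.monotoneOn _) hF.map_zero.ge (a := L + 1) (by linarith) hlin
      (continuousOn_const.locallyIntegrableOn measurableSet_Ici)
      (Eventually.of_forall fun t => le_rfl) continuousOn_const (fun _ _ => le_rfl) fun t ht => ?_
    simpa [hF.map_zero] using hk₀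
  obtain ⟨r, hrm, hrV, hr⟩ := exists_seq_tendsto_sSup hne hbdd
  choose c hc hcr using hr
  obtain ⟨d, hd, hdV, hd0⟩ := OptimalGrowth.exists_admissible_le_intertemporalUtility hρ hF hu hk₀
    hc hrm hrV fun n => (hcr n).ge
  have hle : ∀ e ∈ OptimalGrowth.admissible F k₀,
      OptimalGrowth.intertemporalUtility u ρ e ≤ OptimalGrowth.intertemporalUtility u ρ d :=
    fun e he => (le_csSup hbdd ⟨e, he, rfl⟩).trans hdV
  refine ⟨d, hd, le_antisymm (le_csSup hbdd ⟨d, hd, rfl⟩) hdV, fun t _ => hd0 t, fun T hT => ?_⟩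
  obtain ⟨N, hN⟩ := OptimalGrowth.exists_ae_le_of_forall_intertemporalUtility_le hρ hF hu hint hd
    hle hT
  rw [← restrict_Ioc_eq_restrict_Icc]
  refine memLp_top_of_bound (hd.1.aestronglyMeasurable.mono_measure
    (Measure.restrict_mono (fun s hs => hs.1.le) le_rfl)) N ?_
  filter_upwards [hN] with t ht
  rwa [Real.norm_of_nonneg (hd0 t)]
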